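/- **Notation.** For a finite-dimensional Euclidean space $E$ (below $E=\mathbb{R}^n$ or $E=\mathbb{R}^n\times\mathbb{R}$) and $f\colon E\to\mathbb{R}\cup\{+\infty\}$, let $\mathrm{dom}\, f=\{x: f(x)<+\infty\}$, let $f^*(p)=\sup_{x}\{\langle p,x\rangle-f(x)\}$ be its Legendre–Fenchel transform, and let $\partial f(x)=\{p:\ f(y)\ge f(x)+\langle p,y-x\rangle\ \forall y\}$ be its subdifferential. $\Gamma_0(E)$ is the set of proper, convex, lower semicontinuous functions $E\to\mathbb{R}\cup\{+\infty\}$. $I_C$ is the indicator function of a set $C$ ($0$ on $C$, $+\infty$ off $C$). A function $f$ is 1-coercive if $f(x)/\|x\|\to+\infty$ as $\|x\|\to+\infty$. A function $f\in\Gamma_0(E)$ is Legendre if $\mathrm{int}\,\mathrm{dom}\, f\neq\emptyset$, $f$ is differentiable and strictly convex on $\mathrm{int}\,\mathrm{dom}\, f$, $\partial f(x)=\{\nabla f(x)\}$ for $x\in\mathrm{int}\,\mathrm{dom}\, f$, and $\partial f(x)=\emptyset$ for $x\in\mathrm{dom}\, f\setminus\mathrm{int}\,\mathrm{dom}\, f$.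 **Assumption.** $J,H\in\Gamma_0(\mathbb{R}^n)$, $J$ is 1-coercive, and $H$ is Legendre. Define $S\colon\mathbb{R}^n\times\mathbb{R}\to\mathbb{R}\cup\{+\infty\}$ by $$S(x,t)=\begin{cases}\inf_{v\in\mathbb{R}^n}\{J(x-tv)+tH^*(v)\}, & t>0,\\ (J^*+I_{\mathrm{dom}\, H})^*(x), & t=0,\\ +\infty, & t<0.\end{cases}$$ **Proposition.** The following statements hold. (a) $S$ is proper, convex and lower semicontinuous in the joint variable $(x,t)$ (in particular it never takes the value $-\infty$), and for all $p\in\mathbb{R}^n$, $E^-\in\mathbb{R}$, $$S^*(p,E^-)=J^*(p)+I_{\{(p,E^-)\in(\mathrm{dom}\, H)\times\mathbb{R}:\ E^-+H(p)\le 0\}}(p,E^-).$$ (b) The domain of $S$ is $$\mathrm{dom}\, S=\Big(\bigcup_{t>0}(\mathrm{dom}\, J+t\,\mathrm{dom}\, H^*)\times\{t\}\Big)\cup\Big((\mathrm{dom}\, J+\mathrm{dom}\,(I_{\mathrm{dom}\, H}^*))\times\{0\}\Big),$$ and its interior is $$\mathrm{int}\,\mathrm{dom}\, S=\bigcup_{t>0}(\mathrm{dom}\,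 J+t\,\mathrm{int}\,\mathrm{dom}\, H^*)\times\{t\}.$$ (c) For every $(x,t)\in\mathrm{int}\,\mathrm{dom}\, S$, the function $p\mapsto\langle p,x\rangle-tH(p)-J^*(p)$ has a unique maximizer $\bar p$ over $\mathbb{R}^n$, $\bar p\in\mathrm{dom}\, H$, $S$ is differentiable at $(x,t)$, and $\nabla S(x,t)=(\bar p,-H(\bar p))$. (d) There exists $J_S\in\Gamma_0(\mathbb{R}^n)$ with $\mathrm{dom}\, J_S^*=\mathrm{cl}\,\mathrm{dom}\, H$ and $J_S^*=J^*$ on $\mathrm{dom}\, J_S^*$, and for every such $J_S$ the function $S$ solves the Hamilton–Jacobi equation $$\frac{\partial S}{\partial t}(x,t)+H(\nabla_xS(x,t))=0\ \text{ for }(x,t)\in\mathrm{int}\,\mathrm{dom}\, S,\qquad S(x,0)=J_S(x)\ \text{ for }x\in\mathbb{R}^n,$$ where on $\mathrm{int}\,\mathrm{dom}\, S$ the partial derivatives exist. (e) $S(x,0)\le J(x)$ for all $x\in\mathbb{R}^n$. If $x\in\mathrm{dom}\, J$ satisfies $\partial J(x)\cap\mathrm{cl}\,\mathrm{dom}\,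 H\ne\emptyset$, then $S(x,0)=J(x)$ and $\partial_xS(x,0)=\partial J(x)\cap\mathrm{cl}\,\mathrm{dom}\, H$, where $\partial_xS(x,0)$ is the subdifferential at $x$ of $y\mapsto S(y,0)$. -/

import Mathlib

open Set Filter Topology
open scoped Pointwise

namespace ConvexHJ

noncomputable section

/-! Extended-real-valued functions are functions into `EReal`; a function with values in
`ℝ ∪ {+∞}` is one that never takes the value `⊥`. -/

/-- The (effective) domain of `f`. -/
def dom {E : Type*} (f : E → EReal) : Set E := {x | f x < ⊤}

open Classical in
/-- The indicator function of convex analysis: `0` on `C` and `+∞` off `C`. -/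
def ind {E : Type*} (C : Set E) : E → EReal := fun x => if x ∈ C then 0 else ⊤

section InnerProduct

variable {E : Type*} [NormedAddCommGroup E] [InnerProductSpace ℝ E]

/-- The class `Γ₀` of proper, convex, lower semicontinuous functions `E → ℝ ∪ {+∞}`. Convexity
is convexity of the epigraph. -/
structure IsGammaZero (f : E → EReal) : Prop where
  ne_bot : ∀ x, f x ≠ ⊥
  proper : (dom f).Nonempty
  convex : Convex ℝ {q : E × ℝ | f q.1 ≤ (q.2 : EReal)}
  lsc : LowerSemicontinuous f

/-- The Legendre-Fenchel transform `f^*(p) = sup_x (⟨p, x⟩ - f x)`. -/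
def conj (f : E → EReal) : E → EReal := fun p => ⨆ x, (((inner ℝ p x : ℝ) : EReal) - f x)

/-- The subdifferential `∂f(x)`. -/
def subdiff (f : E → EReal) (x : E) : Set E :=
  {p | ∀ y, f x + ((inner ℝ p (y - x) : ℝ) : EReal) ≤ f y}

/-- `f` is 1-coercive: `f x / ‖x‖ → +∞` as `‖x‖ → +∞`. -/
def IsOneCoercive (f : E → EReal) : Prop :=
  Tendsto (fun x => f x / ((‖x‖ : ℝ) : EReal)) (Bornology.cobounded E) (𝓝 ⊤)

/-- Legendre functions (convex functions of Legendre type). On the interior of its domain a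
function in `Γ₀` is real-valued, so there it is identified with its real part. -/
structure IsLegendre [CompleteSpace E] (f : E → EReal) : Prop where
  gammaZero : IsGammaZero f
  interior_nonempty : (interior (dom f)).Nonempty
  differentiable : ∀ x ∈ interior (dom f), DifferentiableAt ℝ (fun y => (f y).toReal) x
  subdiff_boundary : ∀ x ∈ dom f \ interior (dom f), subdiff f x = ∅
  subdiff_interior : ∀ x ∈ interior (dom f),
    subdiff f x = {gradient (fun y => (f y).toReal) x}
  strictConvex : StrictConvexOn ℝ (interior (dom f)) (fun y => (f y).toReal)

/-- The value function `S(x, t)`. -/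
def S (J H : E → EReal) (x : E) (t : ℝ) : EReal :=
  if 0 < t then ⨅ v : E, (J (x - t • v) + (t : EReal) * conj H v)
  else if t = 0 then conj (fun p => conj J p + ind (dom H) p) x
  else ⊤

/-- `S` as a function of the joint variable `(x, t)` of the Euclidean space `E × ℝ`, whose inner
product is `⟨(p, e), (x, t)⟩ = ⟨p, x⟩ + e t`. -/
def SJoint (J H : E → EReal) (z : WithLp 2 (E × ℝ)) : EReal := S J H z.fst z.snd

/-- The concave function `p ↦ ⟨p, x⟩ - t H(p) - J^*(p)`. -/
def dualObjective (J H : E → EReal) (x : E) (t : ℝ) (p : E) : EReal :=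
  ((inner ℝ p x : ℝ) : EReal) - (t : EReal) * H p - conj J p

/-- `p` is the unique maximizer of `f` over the whole space. -/
def IsUniqueMaximizer (f : E → EReal) (p : E) : Prop :=
  (∀ q, f q ≤ f p) ∧ ∀ r, (∀ q, f q ≤ f r) → r = p

/-- The condition on the initial datum `J_S`: it is in `Γ₀`, `dom J_S^* = cl dom H`, and
`J_S^* = J^*` on `dom J_S^*`. -/
structure IsInitialDatum (J H JS : E → EReal) : Prop where
  gammaZero : IsGammaZero JS
  dom_conj : dom (conj JS) = closure (dom H)
  conj_eq : ∀ p ∈ dom (conj JS), conj JS p = conj J p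

/-- `u` solves `∂u/∂t + H(∇ₓ u) = 0` in the interior of the domain of `u` (as a function of
`(x, t)`), with `u(·, 0) = u₀`. The partial derivatives are required to exist, and the equation
holds between extended reals, so `H(∇ₓ u)` is finite. -/
def SolvesHJ [CompleteSpace E] (H u₀ : E → EReal) (u : E → ℝ → EReal) : Prop :=
  (∀ x t, (x, t) ∈ interior {z : E × ℝ | u z.1 z.2 < ⊤} →
    DifferentiableAt ℝ (fun s => (u x s).toReal) t ∧
    DifferentiableAt ℝ (fun y => (u y t).toReal) x ∧
    ((deriv (fun s => (u x s).toReal) t : ℝ) : EReal)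
      + H (gradient (fun y => (u y t).toReal) x) = 0) ∧
  ∀ x, u x 0 = u₀ x

end InnerProduct

end

end ConvexHJ

open ConvexHJ

/-! The value function is a conjugate. Let K(p, e) = J^*(p) if H(p) ≤ -e and +∞ otherwise
(`jointConj`). Coercivity makes J^* finite, so K is in Γ₀, and `conj_jointConj` shows K^* = S:
maximising te over e ≤ -H(p) gives -tH(p) for t > 0, leaves only p ∈ dom H for t = 0, and gives +∞
for t < 0. For t > 0, Fenchel duality (`exists_conj_le_conj_le_of_add`) turns (J^* + tH)^* into the
infimum over v, with attainment. Fenchel-Moreau then gives S^* = K.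

At t > 0, equality in Fenchel-Young makes every subgradient of S equal to (p, -H(p)) with p a dual
maximizer. An optimal v lies in ∂H(p), so p is in int dom H because H is Legendre; strict convexity
there makes p unique. A convex function with a single subgradient at an interior point is
differentiable there, and the equation is read off the gradient (p, -H(p)).

At t = 0, continuity of J^* allows dom H to be replaced by its closure, so S(·, 0) is the conjugate
of a Γ₀ function; (d) and (e) follow by biconjugation. -/

namespace ConvexHJ

/-! ### Conjugates, affine minorants and the Fenchel-Moreau theorem -/

section Conjugate

variable {E : Type*} [NormedAddCommGroup E] [InnerProductSpace ℝ E]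

lemma coe_sub_le_coe_iff {a c : ℝ} {y : EReal} :
    (a : EReal) - y ≤ c ↔ ((a - c : ℝ) : EReal) ≤ y := by
  induction y with
  | bot => simp [-EReal.coe_sub]
  | top => simp
  | coe y => norm_cast; constructor <;> intro h <;> linarith

lemma exists_coe_of_mem_dom {α : Type*} {f : α → EReal} {x : α} (hb : f x ≠ ⊥)
    (hx : x ∈ dom f) : ∃ a : ℝ, f x = a :=
  ⟨(f x).toReal, (EReal.coe_toReal (ne_of_lt hx) hb).symm⟩

/-- Testing against real upper bounds keeps later arguments in real arithmetic, away from the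
conventions for ⊤ - ⊤. -/
lemma le_of_forall_le_coe {a b : EReal} (h : ∀ c : ℝ, b ≤ c → a ≤ c) : a ≤ b :=
  EReal.le_of_forall_lt_iff_le.1 fun c hc => h c hc.le

lemma conj_le_coe_iff {f : E → EReal} {p : E} {c : ℝ} :
    conj f p ≤ c ↔ ∀ x, ((inner ℝ p x - c : ℝ) : EReal) ≤ f x := by
  simp only [conj, iSup_le_iff, coe_sub_le_coe_iff]

lemma inner_sub_le_conj (f : E → EReal) (p x : E) :
    ((inner ℝ p x : ℝ) : EReal) - f x ≤ conj f p :=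
  le_iSup (fun x => ((inner ℝ p x : ℝ) : EReal) - f x) x

/-- The Fenchel-Young inequality for real values. -/
lemma inner_le_add_of_le {f : E → EReal} {p x : E} {a c : ℝ} (ha : f x ≤ a)
    (hc : conj f p ≤ c) : inner ℝ p x ≤ a + c := by
  have := (conj_le_coe_iff.1 hc x).trans ha
  have := EReal.coe_le_coe_iff.1 this
  linarith

lemma conj_ne_bot {f : E → EReal} (hf : (dom f).Nonempty) (p : E) : conj f p ≠ ⊥ := by
  obtain ⟨x, hx⟩ := hf
  intro h
  have h1 := inner_sub_le_conj f p x
  rw [h, le_bot_iff, sub_eq_add_neg, EReal.add_eq_bot_iff] at h1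
  rcases h1 with h1 | h1
  · exact EReal.coe_ne_bot _ h1
  · exact (ne_of_lt hx) (EReal.neg_eq_bot_iff.1 h1)

lemma conj_antitone {f g : E → EReal} (h : ∀ x, f x ≤ g x) (p : E) : conj g p ≤ conj f p :=
  iSup_mono fun x => EReal.sub_le_sub le_rfl (h x)

lemma lowerSemicontinuous_conj (f : E → EReal) : LowerSemicontinuous (conj f) := by
  refine lowerSemicontinuous_iSup fun x => Continuous.lowerSemicontinuous ?_
  rcases h : f x with _ | _ | a
  · change Continuous fun p => ((inner ℝ p x : ℝ) : EReal) - ⊥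
    simpa using continuous_const
  · change Continuous fun p => ((inner ℝ p x : ℝ) : EReal) - ⊤
    simpa using continuous_const
  · change Continuous fun p => ((inner ℝ p x : ℝ) : EReal) - (a : EReal)
    norm_cast
    exact continuous_coe_real_ereal.comp (by fun_prop)

lemma convex_epigraph_conj (f : E → EReal) :
    Convex ℝ {q : E × ℝ | conj f q.1 ≤ (q.2 : EReal)} := by
  simp only [conj_le_coe_iff, ofPred_forall]
  refine convex_iInter fun x => ?_
  intro q hq q' hq' a b ha hb hab
  simp only [mem_ofPred_eq] at *
  have key : inner ℝ (a • q + b • q').1 x - (a • q + b • q').2 ≤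
      max (inner ℝ q.1 x - q.2) (inner ℝ q'.1 x - q'.2) := by
    have h1 := le_max_left (inner ℝ q.1 x - q.2) (inner ℝ q'.1 x - q'.2)
    have h2 := le_max_right (inner ℝ q.1 x - q.2) (inner ℝ q'.1 x - q'.2)
    simp only [Prod.fst_add, Prod.smul_fst, Prod.snd_add, Prod.smul_snd, inner_add_left,
      real_inner_smul_left, smul_eq_mul]
    calc _ = a * (inner ℝ q.1 x - q.2) + b * (inner ℝ q'.1 x - q'.2) := by ring
      _ ≤ a * max (inner ℝ q.1 x - q.2) (inner ℝ q'.1 x - q'.2) +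
          b * max (inner ℝ q.1 x - q.2) (inner ℝ q'.1 x - q'.2) := by gcongr
      _ = _ := by rw [← add_mul, hab, one_mul]
  refine (EReal.coe_le_coe_iff.2 key).trans ?_
  rcases max_choice (inner ℝ q.1 x - q.2) (inner ℝ q'.1 x - q'.2) with h | h <;> rw [h] <;>
    assumption

lemma isGammaZero_conj {f : E → EReal} (hf : (dom f).Nonempty)
    (hf' : (dom (conj f)).Nonempty) : IsGammaZero (conj f) :=
  ⟨conj_ne_bot hf, hf', convex_epigraph_conj f, lowerSemicontinuous_conj f⟩

lemma conj_conj_le (f : E → EReal) (x : E) : conj (conj f) x ≤ f x := by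
  refine le_of_forall_le_coe fun c hc => conj_le_coe_iff.2 fun p => ?_
  by_contra! h
  obtain ⟨r, hr1, hr2⟩ := EReal.lt_iff_exists_real_btwn.1 h
  have h1 := inner_le_add_of_le hc hr1.le
  have h2 := EReal.coe_lt_coe_iff.1 hr2
  rw [real_inner_comm] at h1
  linarith

/-- This is equality in Fenchel-Young; it reduces every subdifferential computation to one about
conjugates. -/
lemma mem_subdiff_iff_conj_le {f : E → EReal} {x p : E} {a : ℝ} (ha : f x = a) :
    p ∈ subdiff f x ↔ conj f p ≤ ((inner ℝ p x - a : ℝ) : EReal) := by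
  rw [conj_le_coe_iff]
  refine forall_congr' fun y => ?_
  rw [ha, ← EReal.coe_add, inner_sub_right]
  ring_nf

lemma IsGammaZero.isClosed_epigraph {f : E → EReal} (hf : IsGammaZero f) :
    IsClosed {q : E × ℝ | f q.1 ≤ (q.2 : EReal)} := by
  have h : Continuous fun q : E × ℝ => ((q.1, (q.2 : EReal)) : E × EReal) :=
    continuous_fst.prodMk (continuous_coe_real_ereal.comp continuous_snd)
  exact hf.lsc.isClosed_epigraph.preimage h

variable [CompleteSpace E]

lemma exists_inner_eq_apply_prod (φ : StrongDual ℝ (E × ℝ)) :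
    ∃ (p : E) (s : ℝ), ∀ x r, φ (x, r) = inner ℝ p x + s * r := by
  refine ⟨(InnerProductSpace.toDual ℝ E).symm (φ.comp (ContinuousLinearMap.inl ℝ E ℝ)),
    φ (0, 1), fun x r => ?_⟩
  rw [InnerProductSpace.toDual_symm_apply]
  have : ((x, r) : E × ℝ) = (x, 0) + r • ((0, 1) : E × ℝ) := by simp
  rw [this, map_add, map_smul]
  simp [mul_comm]

/-- Hahn-Banach for a point below the closed convex epigraph. The sign of `s` holds because
epigraphs are unbounded upwards; `s = 0` is a vertical hyperplane. -/
lemma IsGammaZero.exists_separating {f : E → EReal} (hf : IsGammaZero f) {x : E} {r : ℝ}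
    (hr : (r : EReal) < f x) : ∃ (p : E) (s u : ℝ), 0 ≤ s ∧ u < inner ℝ p x - s * r ∧
      ∀ y (q : ℝ), f y ≤ q → inner ℝ p y - s * q < u := by
  obtain ⟨φ, u, h1, h2⟩ := geometric_hahn_banach_closed_point hf.convex hf.isClosed_epigraph
    (x := (x, r)) (by simpa using hr)
  obtain ⟨p, s, hps⟩ := exists_inner_eq_apply_prod φ
  have key : ∀ y (q : ℝ), f y ≤ q → inner ℝ p y + s * q < u := fun y q hy => by
    rw [← hps]; exact h1 (y, q) hy
  rw [hps] at h2
  refine ⟨p, -s, u, ?_, by linarith, fun y q hy => by have := key y q hy; linarith⟩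
  obtain ⟨y, hy⟩ := hf.proper
  obtain ⟨a, ha⟩ := exists_coe_of_mem_dom (hf.ne_bot y) hy
  by_contra! hs
  have hs : 0 < s := by linarith
  set d := |u - inner ℝ p y - s * a| / s with hd
  have hd0 : 0 ≤ d := by positivity
  have h3 := key y (a + d) (by rw [ha]; exact_mod_cast (by linarith))
  have h4 : s * d = |u - inner ℝ p y - s * a| := by rw [hd]; field_simp
  have := le_abs_self (u - inner ℝ p y - s * a)
  nlinarith

lemma IsGammaZero.exists_affine_minorant {f : E → EReal} (hf : IsGammaZero f) {x : E} {r : ℝ}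
    (hr : (r : EReal) < f x) : ∃ (p : E) (c : ℝ),
      conj f p ≤ c ∧ r < inner ℝ p x - c := by
  have normalise : ∀ {z : E} {p : E} {s u t : ℝ}, 0 < s → u < inner ℝ p z - s * t →
      (∀ y (q : ℝ), f y ≤ q → inner ℝ p y - s * q < u) →
      ∃ (p : E) (c : ℝ), conj f p ≤ c ∧ t < inner ℝ p z - c := by
    intro z p s u t hs h1 h2
    refine ⟨s⁻¹ • p, s⁻¹ * u, conj_le_coe_iff.2 fun y => le_of_forall_le_coe fun q hq => ?_, ?_⟩
    · rw [EReal.coe_le_coe_iff, real_inner_smul_left, ← mul_sub, inv_mul_le_iff₀ hs]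
      linarith [h2 y q hq]
    · rw [real_inner_smul_left, ← mul_sub, lt_inv_mul_iff₀ hs]
      linarith
  obtain ⟨p, s, u, hs, h1, h2⟩ := hf.exists_separating hr
  rcases hs.lt_or_eq with hs | rfl
  · exact normalise hs h1 h2
  obtain ⟨y, hy⟩ := hf.proper
  obtain ⟨a, ha⟩ := exists_coe_of_mem_dom (hf.ne_bot y) hy
  -- The vertical case. Separating a point just below the graph, over a point of the domain, cannot
  -- be vertical, so some affine minorant exists.
  obtain ⟨p', s', u', hs', h1', h2'⟩ := hf.exists_separating (x := y) (r := a - 1)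
    (by rw [ha]; exact_mod_cast (by linarith))
  have hs' : 0 < s' := by
    have := h2' y a ha.le
    nlinarith
  obtain ⟨p₀, c₀, h0, -⟩ := normalise hs' h1' h2'
  simp only [zero_mul, sub_zero] at h1 h2
  -- Adding `k` times the vertical functional, negative on the domain and positive at `x`, keeps a
  -- minorant and lifts it above `r` at `x`.
  set k := (|r - inner ℝ p₀ x + c₀| + 1) / (inner ℝ p x - u) with hk
  have hpos : 0 < inner ℝ p x - u := by linarith
  have hk0 : 0 ≤ k := by positivity
  refine ⟨p₀ + k • p, c₀ + k * u, conj_le_coe_iff.2 fun z => le_of_forall_le_coe fun q hq => ?_,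
    ?_⟩
  · have e1 := h2 z q hq
    have e2 := inner_le_add_of_le hq h0
    rw [EReal.coe_le_coe_iff, inner_add_left, real_inner_smul_left]
    nlinarith
  · have e1 : k * (inner ℝ p x - u) = |r - inner ℝ p₀ x + c₀| + 1 := by rw [hk]; field_simp
    have := le_abs_self (r - inner ℝ p₀ x + c₀)
    rw [inner_add_left, real_inner_smul_left]
    nlinarith

/-- The Fenchel-Moreau theorem. -/
theorem IsGammaZero.conj_conj {f : E → EReal} (hf : IsGammaZero f) : conj (conj f) = f := by
  funext x
  refine le_antisymm (conj_conj_le f x) (le_of_forall_le_coe fun c hc => ?_)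
  by_contra! h
  obtain ⟨p, d, hd, hp⟩ := hf.exists_affine_minorant h
  have := inner_le_add_of_le hd hc
  rw [real_inner_comm] at this
  linarith

lemma IsGammaZero.dom_conj_nonempty {f : E → EReal} (hf : IsGammaZero f) :
    (dom (conj f)).Nonempty := by
  obtain ⟨y, hy⟩ := hf.proper
  obtain ⟨a, ha⟩ := exists_coe_of_mem_dom (hf.ne_bot y) hy
  obtain ⟨p, c, hc, -⟩ := hf.exists_affine_minorant (x := y) (r := a - 1)
    (by rw [ha]; exact_mod_cast (by linarith))
  exact ⟨p, hc.trans_lt (EReal.coe_lt_top c)⟩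

lemma IsGammaZero.isGammaZero_conj {f : E → EReal} (hf : IsGammaZero f) :
    IsGammaZero (conj f) :=
  ConvexHJ.isGammaZero_conj hf.proper hf.dom_conj_nonempty

end Conjugate

end ConvexHJ

namespace ConvexHJ

/-! ### Adding an indicator function -/

section Indicator

variable {α : Type*}

lemma add_ind_of_mem {f : α → EReal} {C : Set α} {x : α} (h : x ∈ C) : f x + ind C x = f x := by
  simp [ind, h]

lemma add_ind_le_coe_iff {f : α → EReal} {C : Set α} {x : α} {r : ℝ} (hb : f x ≠ ⊥) :
    f x + ind C x ≤ r ↔ x ∈ C ∧ f x ≤ r := by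
  by_cases h : x ∈ C <;> simp [ind, h, EReal.add_top_of_ne_bot hb]

lemma le_add_ind (f : α → EReal) (C : Set α) (x : α) : f x ≤ f x + ind C x := by
  by_cases h : x ∈ C
  · rw [add_ind_of_mem h]
  · by_cases hb : f x = ⊥
    · simp [hb]
    · simp [ind, h, EReal.add_top_of_ne_bot hb]

lemma add_ind_ne_bot {f : α → EReal} {C : Set α} {x : α} (hb : f x ≠ ⊥) :
    f x + ind C x ≠ ⊥ := fun h => hb (le_bot_iff.1 (h ▸ le_add_ind f C x))

lemma dom_add_ind {f : α → EReal} {C : Set α} (hb : ∀ x, f x ≠ ⊥) :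
    dom (fun x => f x + ind C x) = dom f ∩ C := by
  ext x
  by_cases h : x ∈ C <;> simp [dom, ind, h, EReal.add_top_of_ne_bot (hb x)]

end Indicator

/-! ### Convex functions: Fenchel duality, subgradients, differentiability -/

section Convexity

variable {E : Type*} [NormedAddCommGroup E] [InnerProductSpace ℝ E]

lemma le_combo_of_convex_epigraph {f : E → EReal}
    (hf : Convex ℝ {q : E × ℝ | f q.1 ≤ (q.2 : EReal)}) {x y : E} {r s a b : ℝ}
    (hx : f x ≤ r) (hy : f y ≤ s) (ha : 0 ≤ a) (hb : 0 ≤ b) (hab : a + b = 1) :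
    f (a • x + b • y) ≤ ((a * r + b * s : ℝ) : EReal) :=
  hf (x := (x, r)) hx (y := (y, s)) hy ha hb hab

lemma convexOn_toReal {f : E → EReal} (hb : ∀ x, f x ≠ ⊥)
    (hf : Convex ℝ {q : E × ℝ | f q.1 ≤ (q.2 : EReal)}) :
    ConvexOn ℝ (dom f) fun x => (f x).toReal := by
  have key : ∀ {x}, x ∈ dom f → ∀ {y}, y ∈ dom f → ∀ {a b : ℝ}, 0 ≤ a → 0 ≤ b → a + b = 1 →
      f (a • x + b • y) ≤ ((a * (f x).toReal + b * (f y).toReal : ℝ) : EReal) := by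
    intro x hx y hy a b ha h'b hab
    exact le_combo_of_convex_epigraph hf (EReal.coe_toReal (ne_of_lt hx) (hb x)).ge
      (EReal.coe_toReal (ne_of_lt hy) (hb y)).ge ha h'b hab
  refine ⟨fun x hx y hy a b ha h'b hab => (key hx hy ha h'b hab).trans_lt (EReal.coe_lt_top _),
    fun x hx y hy a b ha h'b hab => ?_⟩
  exact EReal.toReal_le_toReal (key hx hy ha h'b hab) (hb _) (EReal.coe_ne_top _)

/-- Restricting a function of class `Γ₀` to a closed convex set. -/
lemma IsGammaZero.add_ind {f : E → EReal} (hf : IsGammaZero f) {C : Set E} (hC : Convex ℝ C)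
    (hCc : IsClosed C) (hne : (dom f ∩ C).Nonempty) :
    IsGammaZero fun x => f x + ind C x := by
  refine ⟨fun x => add_ind_ne_bot (hf.ne_bot x), by rwa [dom_add_ind hf.ne_bot], ?_, ?_⟩
  · have : {q : E × ℝ | f q.1 + ind C q.1 ≤ (q.2 : EReal)} =
        C ×ˢ univ ∩ {q : E × ℝ | f q.1 ≤ (q.2 : EReal)} := by
      ext q
      simp [add_ind_le_coe_iff (hf.ne_bot q.1)]
    rw [this]
    exact (hC.prod convex_univ).inter hf.convex
  · rw [lowerSemicontinuous_iff_isClosed_preimage]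
    intro r
    by_cases hr : r = ⊤
    · simp [hr]
    have : (fun x => f x + ind C x) ⁻¹' Iic r = C ∩ f ⁻¹' Iic r := by
      ext x
      by_cases h : x ∈ C <;> simp [ind, h, EReal.add_top_of_ne_bot (hf.ne_bot x), hr]
    rw [this]
    exact hCc.inter (hf.lsc.isClosed_preimage r)

lemma IsGammaZero.dom_convex {f : E → EReal} (hf : IsGammaZero f) : Convex ℝ (dom f) :=
  (convexOn_toReal hf.ne_bot hf.convex).1

lemma continuousOn_toReal [FiniteDimensional ℝ E] {f : E → EReal} (hb : ∀ x, f x ≠ ⊥)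
    (hf : Convex ℝ {q : E × ℝ | f q.1 ≤ (q.2 : EReal)}) :
    ContinuousOn (fun x => (f x).toReal) (interior (dom f)) :=
  (convexOn_toReal hb hf).continuousOn_interior

/-- For finite convex `g`, conjugation of `g + ind D` does not see the difference between `D` and
its closure. -/
lemma conj_add_ind_closure [FiniteDimensional ℝ E] {g : E → EReal} (hg : ∀ p, g p ≠ ⊥) (hg' : ∀ p, g p < ⊤)
    (hgc : Convex ℝ {q : E × ℝ | g q.1 ≤ (q.2 : EReal)}) (D : Set E) :
    conj (fun p => g p + ind (closure D) p) = conj fun p => g p + ind D p := by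
  have hdom : dom g = univ := eq_univ_of_forall hg'
  have hGcont : Continuous fun p => (g p).toReal := by
    have := continuousOn_toReal hg hgc
    rwa [hdom, interior_univ, continuousOn_univ] at this
  have hgG : ∀ p, g p = (g p).toReal := fun p => (EReal.coe_toReal (ne_of_lt (hg' p)) (hg p)).symm
  funext x
  refine le_antisymm (le_of_forall_le_coe fun c hc => conj_le_coe_iff.2 fun p => ?_)
    (conj_antitone (fun p => ?_) x)
  · by_cases hp : p ∈ closure D
    · rw [add_ind_of_mem hp, hgG, EReal.coe_le_coe_iff]
      -- A finite convex function is continuous, so the affine bound is a closed condition and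
      -- passes from `D` to its closure.
      refine closure_minimal (s := D) (t := {p | inner ℝ x p - c ≤ (g p).toReal})
        (fun q hq => ?_) (isClosed_le (by fun_prop) hGcont) hp
      have := conj_le_coe_iff.1 hc q
      rwa [add_ind_of_mem hq, hgG, EReal.coe_le_coe_iff] at this
    · simp [ind, hp, EReal.add_top_of_ne_bot (hg p)]
  · by_cases hp : p ∈ D
    · rw [add_ind_of_mem hp, add_ind_of_mem (subset_closure hp)]
    · simp [ind, hp, EReal.add_top_of_ne_bot (hg p)]

variable [CompleteSpace E]

/-- Far out, coercivity gives f(x) ≥ ‖p‖‖x‖ ≥ ⟨p, x⟩. On the remaining ball, an affine minorant with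
slope `p₀` differs from the wanted one by a bounded amount. -/
lemma IsOneCoercive.conj_lt_top {f : E → EReal} (hc : IsOneCoercive f) (hf : IsGammaZero f)
    (p : E) : conj f p < ⊤ := by
  obtain ⟨p₀, hp₀⟩ := hf.dom_conj_nonempty
  obtain ⟨c₀, h0⟩ := exists_coe_of_mem_dom (conj_ne_bot hf.proper p₀) hp₀
  have h1 : ∀ᶠ x in Bornology.cobounded E, ((‖p‖ : ℝ) : EReal) < f x / ((‖x‖ : ℝ) : EReal) :=
    hc.eventually_const_lt (EReal.coe_lt_top _)
  obtain ⟨R, -, hR⟩ := (hasBasis_cobounded_norm (E := E)).eventually_iff.1 h1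
  have h2 : conj f p ≤ ((|c₀| + ‖p - p₀‖ * max R 0 : ℝ) : EReal) := by
    refine conj_le_coe_iff.2 fun x => ?_
    have hnn : 0 ≤ ‖p - p₀‖ * max R 0 := by positivity
    rcases le_or_gt ‖x‖ (max R 0) with hx | hx
    · refine le_trans (EReal.coe_le_coe_iff.2 ?_) (conj_le_coe_iff.1 h0.le x)
      have e1 : inner ℝ p x = inner ℝ p₀ x + inner ℝ (p - p₀) x := by
        rw [inner_sub_left]; ring
      have e2 := real_inner_le_norm (p - p₀) x
      have e3 : ‖p - p₀‖ * ‖x‖ ≤ ‖p - p₀‖ * max R 0 := by gcongr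
      linarith [le_abs_self c₀]
    · have hx0 : 0 < ‖x‖ := (le_max_right _ _).trans_lt hx
      have e1 := (hR (mem_ofPred.2 ((le_max_left _ _).trans hx.le))).le
      rw [EReal.le_div_iff_mul_le (by exact_mod_cast hx0) (EReal.coe_ne_top _),
        ← EReal.coe_mul] at e1
      refine le_trans (EReal.coe_le_coe_iff.2 ?_) e1
      linarith [real_inner_le_norm p x, abs_nonneg c₀]
  exact h2.trans_lt (EReal.coe_lt_top _)

variable [FiniteDimensional ℝ E]

/-- Fenchel duality for the sum of a finite convex function and a proper convex function: if the
conjugate of the sum is at most `α` at `x`, then so is the infimal convolution of the conjugates,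
and the infimum is attained. -/
theorem exists_conj_le_conj_le_of_add {g h : E → EReal} (hg : ∀ p, g p ≠ ⊥)
    (hg' : ∀ p, g p < ⊤) (hgc : Convex ℝ {q : E × ℝ | g q.1 ≤ (q.2 : EReal)})
    (hh : (dom h).Nonempty) (hhb : ∀ p, h p ≠ ⊥)
    (hhc : Convex ℝ {q : E × ℝ | h q.1 ≤ (q.2 : EReal)}) {x : E} {α : ℝ}
    (hα : conj (fun p => g p + h p) x ≤ α) :
    ∃ (w : E) (b : ℝ), conj g w ≤ b ∧ conj h (x - w) ≤ ((α - b : ℝ) : EReal) := by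
  set G : E → ℝ := fun p => (g p).toReal with hG
  have hdom : dom g = univ := eq_univ_of_forall hg'
  have hgG : ∀ p, g p = G p := fun p => (EReal.coe_toReal (ne_of_lt (hg' p)) (hg p)).symm
  have hGconv : ConvexOn ℝ univ G := hdom ▸ convexOn_toReal hg hgc
  have hGcont : Continuous G := by
    have := continuousOn_toReal hg hgc
    rwa [hdom, interior_univ, continuousOn_univ] at this
  have hAo : IsOpen {q : E × ℝ | G q.1 < q.2} :=
    isOpen_lt (hGcont.comp continuous_fst) continuous_snd
  have hAc : Convex ℝ {q : E × ℝ | G q.1 < q.2} := by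
    simpa using hGconv.convex_strict_epigraph
  have hBc : Convex ℝ {q : E × ℝ | h q.1 ≤ ((inner ℝ x q.1 - α - q.2 : ℝ) : EReal)} := by
    intro q hq q' hq' a b ha hb hab
    have := le_combo_of_convex_epigraph hhc hq hq' ha hb hab
    refine this.trans (EReal.coe_le_coe_iff.2 (le_of_eq ?_))
    simp only [Prod.fst_add, Prod.smul_fst, Prod.snd_add, Prod.smul_snd, inner_add_right,
      real_inner_smul_right, smul_eq_mul]
    linear_combination -α * hab
  -- The strict epigraph of `g` is separated from the hypograph of ⟨x, ·⟩ - α - h; the bound on the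
  -- conjugate says they do not meet.
  have hdisj : Disjoint {q : E × ℝ | G q.1 < q.2}
      {q : E × ℝ | h q.1 ≤ ((inner ℝ x q.1 - α - q.2 : ℝ) : EReal)} := by
    refine Set.disjoint_left.2 fun q hq hq' => ?_
    have h1 := conj_le_coe_iff.1 hα q.1
    have h2 : g q.1 + h q.1 ≤ ((G q.1 + (inner ℝ x q.1 - α - q.2) : ℝ) : EReal) := by
      rw [hgG, EReal.coe_add]
      exact add_le_add_right hq' _
    have h3 := EReal.coe_le_coe_iff.1 (h1.trans h2)
    simp only [mem_ofPred_eq] at hq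
    linarith
  obtain ⟨φ, u, hA, hB⟩ := geometric_hahn_banach_open hAc hAo hBc hdisj
  obtain ⟨w, s, hws⟩ := exists_inner_eq_apply_prod φ
  replace hA : ∀ p r, G p < r → inner ℝ w p + s * r < u := fun p r hr => by
    rw [← hws]; exact hA (p, r) hr
  replace hB : ∀ p (q : ℝ), h p ≤ q → u ≤ inner ℝ w p + s * (inner ℝ x p - α - q) :=
    fun p q hq => by
      rw [← hws]
      refine hB (p, inner ℝ x p - α - q) ?_
      rw [mem_ofPred_eq, sub_sub_cancel]
      exact hq
  -- The hyperplane is not vertical: `g` is finite, so both sets have points over any point of dom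
  -- h.
  have hs : s < 0 := by
    obtain ⟨p, hp⟩ := hh
    obtain ⟨q, hq⟩ := exists_coe_of_mem_dom (hhb p) hp
    have h1 := hB p q hq.le
    have h2 := hA p (|G p| + |inner ℝ x p - α - q| + 1)
      (by linarith [le_abs_self (G p), abs_nonneg (inner ℝ x p - α - q)])
    by_contra! hs
    have : s * (inner ℝ x p - α - q) ≤ s * (|G p| + |inner ℝ x p - α - q| + 1) := by
      gcongr
      linarith [le_abs_self (inner ℝ x p - α - q), abs_nonneg (G p)]
    linarith
  obtain ⟨k, rfl⟩ : ∃ k, s = -k := ⟨-s, by ring⟩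
  have hk : 0 < k := by linarith
  refine ⟨k⁻¹ • w, k⁻¹ * u, conj_le_coe_iff.2 fun p => ?_, conj_le_coe_iff.2 fun p =>
    le_of_forall_le_coe fun q hq => ?_⟩
  · rw [hgG, EReal.coe_le_coe_iff, real_inner_smul_left, ← mul_sub, inv_mul_le_iff₀ hk]
    refine le_of_forall_pos_le_add fun ε hε => ?_
    have h1 := hA p (G p + ε / k) (by have := div_pos hε hk; linarith)
    have h2 : k * (ε / k) = ε := by field_simp
    nlinarith
  · have h1 := hB p q hq
    have h2 : k⁻¹ * u ≤ k⁻¹ * (inner ℝ w p + -k * (inner ℝ x p - α - q)) := by gcongr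
    have h3 : k⁻¹ * (inner ℝ w p + -k * (inner ℝ x p - α - q)) =
        k⁻¹ * inner ℝ w p - (inner ℝ x p - α - q) := by field_simp; ring
    rw [EReal.coe_le_coe_iff, inner_sub_left, real_inner_smul_left]
    linarith

/-- A convex function has a subgradient at every interior point of its domain. -/
lemma subdiff_nonempty_of_mem_interior {f : E → EReal} (hb : ∀ x, f x ≠ ⊥)
    (hf : Convex ℝ {q : E × ℝ | f q.1 ≤ (q.2 : EReal)}) {x : E} (hx : x ∈ interior (dom f)) :
    (subdiff f x).Nonempty := by
  set F : E → ℝ := fun y => (f y).toReal with hF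
  have hfF : ∀ y ∈ dom f, f y = F y := fun y hy => (EReal.coe_toReal (ne_of_lt hy) (hb y)).symm
  have hcont : ContinuousOn F (interior (dom f)) := continuousOn_toReal hb hf
  have hconv : ConvexOn ℝ (dom f) F := convexOn_toReal hb hf
  have hAo : IsOpen {q : E × ℝ | q.1 ∈ interior (dom f) ∧ F q.1 < q.2} := by
    have h1 : ContinuousOn (fun q : E × ℝ => q.2 - F q.1) (interior (dom f) ×ˢ univ) :=
      continuousOn_snd.sub (hcont.comp continuousOn_fst fun q hq => hq.1)
    convert h1.isOpen_inter_preimage (isOpen_interior.prod isOpen_univ) (isOpen_Ioi (a := 0))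
      using 1
    ext q
    simp
  have hAc : Convex ℝ {q : E × ℝ | q.1 ∈ interior (dom f) ∧ F q.1 < q.2} :=
    (hconv.subset interior_subset hconv.1.interior).convex_strict_epigraph
  obtain ⟨φ, hφ⟩ := geometric_hahn_banach_open_point hAc hAo (x := (x, F x)) (by simp)
  obtain ⟨w, s, hws⟩ := exists_inner_eq_apply_prod φ
  replace hφ : ∀ y ∈ interior (dom f), ∀ r, F y < r →
      inner ℝ w y + s * r < inner ℝ w x + s * F x := fun y hy r hr => by
    rw [← hws, ← hws]; exact hφ (y, r) ⟨hy, hr⟩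
  have hs : s < 0 := by linarith [hφ x hx (F x + 1) (by linarith)]
  obtain ⟨k, rfl⟩ : ∃ k, s = -k := ⟨-s, by ring⟩
  have hk : 0 < k := by linarith
  have hint : ∀ y ∈ interior (dom f),
      F x - inner ℝ (k⁻¹ • w) x ≤ F y - inner ℝ (k⁻¹ • w) y := by
    intro y hy
    rw [real_inner_smul_left, real_inner_smul_left]
    refine le_of_forall_pos_le_add fun ε hε => ?_
    have h1 := hφ y hy (F y + ε) (by linarith)
    have h2 : k⁻¹ * (inner ℝ w y + -k * (F y + ε)) ≤ k⁻¹ * (inner ℝ w x + -k * F x) := by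
      gcongr
    have h3 : k⁻¹ * (inner ℝ w y + -k * (F y + ε)) = k⁻¹ * inner ℝ w y - F y - ε := by
      field_simp; ring
    have h4 : k⁻¹ * (inner ℝ w x + -k * F x) = k⁻¹ * inner ℝ w x - F x := by
      field_simp; ring
    linarith
  have hconv' : ConvexOn ℝ (dom f) fun y => F y - inner ℝ (k⁻¹ • w) y :=
    hconv.sub ((innerSL ℝ (k⁻¹ • w)).toLinearMap.concaveOn hconv.1)
  -- Separation controls only the interior; a local minimum of a convex function is global, which
  -- covers the rest of the domain.
  have hmin := IsMinOn.of_isLocalMinOn_of_convexOn (interior_subset hx)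
    (f := fun y => F y - inner ℝ (k⁻¹ • w) y) (s := dom f)
    (by filter_upwards [mem_nhdsWithin_of_mem_nhds (isOpen_interior.mem_nhds hx)] with y hy
        exact hint y hy) hconv'
  refine ⟨k⁻¹ • w, fun y => ?_⟩
  by_cases hy : y ∈ dom f
  · have := hmin hy
    simp only [mem_ofPred_eq] at this
    rw [hfF y hy, hfF x (interior_subset hx), ← EReal.coe_add, EReal.coe_le_coe_iff,
      inner_sub_right]
    linarith
  · simp only [dom, mem_ofPred_eq, not_lt, top_le_iff] at hy
    simp [hy]

/-- A convex function with a unique subgradient at an interior point of its domain is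
differentiable there. -/
theorem hasGradientAt_of_subdiff_subset_singleton {f : E → EReal} (hb : ∀ x, f x ≠ ⊥)
    (hf : Convex ℝ {q : E × ℝ | f q.1 ≤ (q.2 : EReal)}) {x g : E} (hx : x ∈ interior (dom f))
    (hg : subdiff f x ⊆ {g}) : HasGradientAt (fun y => (f y).toReal) g x := by
  set F : E → ℝ := fun y => (f y).toReal with hF
  have hfF : ∀ y ∈ dom f, f y = F y := fun y hy => (EReal.coe_toReal (ne_of_lt hy) (hb y)).symm
  have hcont : ContinuousOn F (interior (dom f)) := continuousOn_toReal hb hf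
  have hconv : ConvexOn ℝ (dom f) F := convexOn_toReal hb hf
  have hnhds : interior (dom f) ∈ 𝓝 x := isOpen_interior.mem_nhds hx
  have hsub : ∀ y ∈ dom f, ∀ p, p ∈ subdiff f y ↔
      ∀ z ∈ dom f, F y + inner ℝ p (z - y) ≤ F z := by
    intro y hy p
    refine ⟨fun h z hz => ?_, fun h z => ?_⟩
    · have := h z
      rwa [hfF y hy, hfF z hz, ← EReal.coe_add, EReal.coe_le_coe_iff] at this
    · by_cases hz : z ∈ dom f
      · rw [hfF y hy, hfF z hz, ← EReal.coe_add, EReal.coe_le_coe_iff]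
        exact h z hz
      · simp only [dom, mem_ofPred_eq, not_lt, top_le_iff] at hz
        simp [hz]
  choose! q hq using fun y (hy : y ∈ interior (dom f)) =>
    subdiff_nonempty_of_mem_interior hb hf hy
  replace hq : ∀ y ∈ interior (dom f), ∀ z ∈ dom f, F y + inner ℝ (q y) (z - y) ≤ F z :=
    fun y hy => (hsub y (interior_subset hy) _).1 (hq y hy)
  obtain ⟨K, t, ht, hK⟩ := hconv.locallyLipschitzOn_interior hx
  rw [isOpen_interior.nhdsWithin_eq hx] at ht
  -- A local Lipschitz constant bounds nearby subgradients, as seen by moving from `y` a little in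
  -- the direction `q y`.
  have hbound : ∀ᶠ y in 𝓝 x, q y ∈ Metric.closedBall (0 : E) K := by
    filter_upwards [eventually_mem_nhds_iff.2 (inter_mem ht hnhds)] with y hy
    have hy' : y ∈ t ∩ interior (dom f) := mem_of_mem_nhds hy
    have h1 : Tendsto (fun δ : ℝ => y + δ • q y) (𝓝[>] 0) (𝓝 y) := by
      refine tendsto_nhdsWithin_of_tendsto_nhds ?_
      have : Continuous fun δ : ℝ => y + δ • q y := by fun_prop
      simpa using this.tendsto 0
    obtain ⟨δ, hδ, hδ0⟩ := ((h1.eventually hy).and self_mem_nhdsWithin).exists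
    have hδ0 : 0 < δ := hδ0
    have h2 := hq y hy'.2 _ (interior_subset hδ.2)
    have h3 := hK.dist_le_mul _ hδ.1 _ hy'.1
    rw [Real.dist_eq, dist_eq_norm, add_sub_cancel_left, norm_smul, Real.norm_eq_abs,
      abs_of_pos hδ0] at h3
    rw [add_sub_cancel_left, real_inner_smul_right, real_inner_self_eq_norm_sq] at h2
    have h4 := le_abs_self (F (y + δ • q y) - F y)
    have h5 : δ * (‖q y‖ * ‖q y‖) ≤ δ * (K * ‖q y‖) := by nlinarith
    have h6 := le_of_mul_le_mul_left h5 hδ0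
    rw [mem_closedBall_zero_iff]
    rcases (norm_nonneg (q y)).eq_or_lt with h | h
    · rw [← h]; exact K.2
    · exact le_of_mul_le_mul_right h6 h
  -- Cluster points of `q` at `x` are subgradients at `x`, hence equal `g`; compactness gives
  -- convergence.
  have htend : Tendsto q (𝓝 x) (𝓝 g) := by
    refine (isCompact_closedBall (0 : E) (K : ℝ)).tendsto_nhds_of_unique_mapClusterPt hbound
      fun p _ hp => hg ((hsub x (interior_subset hx) p).2 fun z hz => ?_)
    by_contra! hlt
    have hc : ContinuousAt (fun a : E × E => F a.1 + inner ℝ a.2 (z - a.1)) (x, p) := by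
      have : ContinuousAt (fun a : E × E => F a.1) (x, p) :=
        ContinuousAt.comp (f := Prod.fst) (hcont.continuousAt hnhds) continuousAt_fst
      exact this.add (Continuous.continuousAt (by fun_prop))
    have hev := hc.eventually_const_lt hlt
    rw [nhds_prod_eq] at hev
    obtain ⟨P, hP, Q, hQ, hPQ⟩ := eventually_prod_iff.1 hev
    obtain ⟨y, hy, hyP, hyU⟩ :=
      ((mapClusterPt_iff_frequently.1 hp {p | Q p} hQ).and_eventually
        (hP.and hnhds)).exists
    have := hPQ hyP hy
    linarith [hq y hyU z hz]
  rw [hasGradientAt_iff_isLittleO, Asymptotics.isLittleO_iff]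
  have hgq : g = q x := by
    obtain ⟨p, hp⟩ := subdiff_nonempty_of_mem_interior hb hf hx
    exact (hg ((hsub x (interior_subset hx) _).2 (hq x hx))).symm
  intro c hc
  -- The remainder F y - F x - ⟨g, y - x⟩ lies between 0 and ⟨q y - g, y - x⟩.
  filter_upwards [hnhds, htend.eventually (Metric.closedBall_mem_nhds g hc)] with y hy hyq
  have h1 := hq y hy x (interior_subset hx)
  have h2 := hq x hx y (interior_subset hy)
  rw [← hgq] at h2
  have h3 := real_inner_le_norm (q y - g) (y - x)
  rw [dist_eq_norm] at hyq
  have h4 : ‖q y - g‖ * ‖y - x‖ ≤ c * ‖y - x‖ := by gcongr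
  have h5 : inner ℝ (q y) (x - y) = - inner ℝ (q y) (y - x) := by
    rw [← neg_sub, inner_neg_right]
  rw [inner_sub_left] at h3
  rw [Real.norm_eq_abs, abs_of_nonneg (by linarith)]
  linarith

end Convexity

end ConvexHJ

namespace ConvexHJ

lemma coe_add_le_zero_iff {e : ℝ} {y : EReal} : (e : EReal) + y ≤ 0 ↔ y ≤ ((-e : ℝ) : EReal) := by
  induction y with
  | bot => simp
  | top => simp
  | coe y => norm_cast; constructor <;> intro h <;> linarith

lemma coe_mul_le_coe_iff {t r : ℝ} (ht : 0 < t) {y : EReal} :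
    (t : EReal) * y ≤ r ↔ y ≤ ((t⁻¹ * r : ℝ) : EReal) := by
  induction y with
  | bot => simp [EReal.coe_mul_bot_of_pos ht]
  | top => simp [EReal.coe_mul_top_of_pos ht, -EReal.coe_mul]
  | coe y => norm_cast; rw [le_inv_mul_iff₀ ht]

lemma coe_mul_ne_bot {t : ℝ} (ht : 0 < t) {y : EReal} (hy : y ≠ ⊥) : (t : EReal) * y ≠ ⊥ := by
  induction y with
  | bot => exact absurd rfl hy
  | top => simp [EReal.coe_mul_top_of_pos ht]
  | coe y => rw [← EReal.coe_mul]; exact EReal.coe_ne_bot _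

lemma coe_mul_lt_top_iff {t : ℝ} (ht : 0 < t) {y : EReal} : (t : EReal) * y < ⊤ ↔ y < ⊤ := by
  induction y with
  | bot => simp [EReal.coe_mul_bot_of_pos ht]
  | top => simp [EReal.coe_mul_top_of_pos ht]
  | coe y => rw [← EReal.coe_mul]; simp [-EReal.coe_mul]

lemma dom_ind {α : Type*} (C : Set α) : dom (ind C) = C := by
  ext x
  by_cases h : x ∈ C <;> simp [dom, ind, h]

lemma ind_ne_bot {α : Type*} (C : Set α) (x : α) : ind C x ≠ ⊥ := by
  by_cases h : x ∈ C <;> simp [ind, h]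

lemma mem_dom_and_add_le_zero_iff {α : Type*} {H : α → EReal} {p : α} {e : ℝ} :
    (p, e) ∈ {q : α × ℝ | q.1 ∈ dom H ∧ (q.2 : EReal) + H q.1 ≤ 0} ↔
      H p ≤ ((-e : ℝ) : EReal) := by
  rw [mem_ofPred_eq, coe_add_le_zero_iff]
  exact ⟨fun h => h.2, fun h => ⟨h.trans_lt (EReal.coe_lt_top _), h⟩⟩

/-! ### The value function as a conjugate, and its domain -/

section ValueFunction

variable {E : Type*} [NormedAddCommGroup E] [InnerProductSpace ℝ E]

lemma convex_epigraph_ind {C : Set E} (hC : Convex ℝ C) :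
    Convex ℝ {q : E × ℝ | ind C q.1 ≤ (q.2 : EReal)} := by
  have : {q : E × ℝ | ind C q.1 ≤ (q.2 : EReal)} = C ×ˢ Ici 0 := by
    ext q
    by_cases h : q.1 ∈ C <;> simp [ind, h]
  rw [this]
  exact hC.prod (convex_Ici 0)

/-- The conjugate of the joint value function, see `conj_SJoint`. -/
noncomputable def jointConj (J H : E → EReal) (z : WithLp 2 (E × ℝ)) : EReal :=
  conj J z.fst +
    ind {q : E × ℝ | q.1 ∈ dom H ∧ (q.2 : EReal) + H q.1 ≤ 0} (z.fst, z.snd)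

lemma jointConj_le_coe_iff {J H : E → EReal} (hJ : (dom J).Nonempty) {p : E} {e r : ℝ} :
    jointConj J H (WithLp.toLp 2 (p, e)) ≤ r ↔
      H p ≤ ((-e : ℝ) : EReal) ∧ conj J p ≤ r := by
  rw [← mem_dom_and_add_le_zero_iff]
  exact add_ind_le_coe_iff (f := fun q : E × ℝ => conj J q.1) (x := (p, e)) (conj_ne_bot hJ _)

lemma conj_jointConj_le_coe_iff {J H : E → EReal} (hJ : (dom J).Nonempty) {x : E} {t c : ℝ} :
    conj (jointConj J H) (WithLp.toLp 2 (x, t)) ≤ c ↔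
      ∀ p (e : ℝ), H p ≤ ((-e : ℝ) : EReal) →
        ((inner ℝ p x + t * e - c : ℝ) : EReal) ≤ conj J p := by
  have hin : ∀ (p : E) (e : ℝ), inner ℝ (WithLp.toLp 2 (x, t)) (WithLp.toLp 2 (p, e)) =
      inner ℝ p x + t * e := fun p e => by
    rw [WithLp.prod_inner_apply, real_inner_comm]
    simp [mul_comm]
  rw [conj_le_coe_iff]
  refine ⟨fun h p e hpe => le_of_forall_le_coe fun r hr => ?_, fun h z => ?_⟩
  · rw [← hin]
    exact (h _).trans ((jointConj_le_coe_iff hJ).2 ⟨hpe, hr⟩)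
  · obtain ⟨⟨p, e⟩, rfl⟩ := (WithLp.toLp_surjective 2) z
    rw [hin]
    refine le_of_forall_le_coe fun r hr => ?_
    obtain ⟨h1, h2⟩ := (jointConj_le_coe_iff hJ).1 hr
    exact (h p e h1).trans h2

/-- Weak duality: Fenchel-Young for J at x - tv plus t times Fenchel-Young for H at `p`; the terms
in ⟨p, v⟩ cancel. -/
lemma coe_sub_le_conj_of_le {J H : E → EReal} {x v p : E} {t j k h : ℝ} (ht : 0 ≤ t)
    (hj : J (x - t • v) ≤ j) (hk : conj H v ≤ k) (hp : H p ≤ h) :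
    ((inner ℝ p x - t * h - (j + t * k) : ℝ) : EReal) ≤ conj J p := by
  refine le_of_forall_le_coe fun r hr => EReal.coe_le_coe_iff.2 ?_
  have h1 := inner_le_add_of_le hj hr
  have h2 := inner_le_add_of_le hp hk
  rw [real_inner_comm] at h2
  rw [inner_sub_right, real_inner_smul_right] at h1
  nlinarith

/-- The constraint set is the epigraph of H reflected in the last variable, hence closed and convex
even when dom H is not closed. -/
lemma isGammaZero_jointConj {J H : E → EReal} (hJ : IsGammaZero J) (hJ' : ∀ p, conj J p < ⊤)
    (hH : IsGammaZero H) : IsGammaZero (jointConj J H) := by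
  have h1 : IsGammaZero fun z : WithLp 2 (E × ℝ) => conj J z.fst := by
    refine ⟨fun z => conj_ne_bot hJ.proper _, ⟨0, hJ' _⟩, ?_,
      (lowerSemicontinuous_conj J).comp (by fun_prop)⟩
    intro q hq q' hq' a b ha hb hab
    exact le_combo_of_convex_epigraph (convex_epigraph_conj J) hq hq' ha hb hab
  have hset : {z : WithLp 2 (E × ℝ) | (z.fst, z.snd) ∈
      {q : E × ℝ | q.1 ∈ dom H ∧ (q.2 : EReal) + H q.1 ≤ 0}} =
      {z | H z.fst ≤ ((-z.snd : ℝ) : EReal)} := by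
    ext z
    exact mem_dom_and_add_le_zero_iff
  have h2 := h1.add_ind (C := {z : WithLp 2 (E × ℝ) | (z.fst, z.snd) ∈
      {q : E × ℝ | q.1 ∈ dom H ∧ (q.2 : EReal) + H q.1 ≤ 0}}) ?_ ?_ ?_
  · exact h2
  · rw [hset]
    intro z hz z' hz' a b ha hb hab
    refine (le_combo_of_convex_epigraph hH.convex hz hz' ha hb hab).trans
      (EReal.coe_le_coe_iff.2 (le_of_eq ?_))
    simp
    ring
  · rw [hset]
    exact hH.isClosed_epigraph.preimage
      (f := fun z : WithLp 2 (E × ℝ) => ((z.fst, -z.snd) : E × ℝ)) (by fun_prop)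
  · rw [hset]
    obtain ⟨p, hp⟩ := hH.proper
    obtain ⟨a, ha⟩ := exists_coe_of_mem_dom (hH.ne_bot p) hp
    exact ⟨WithLp.toLp 2 (p, -a), hJ' _, by simp [ha]⟩

section Duality

variable [CompleteSpace E] [FiniteDimensional ℝ E] {J H : E → EReal}

/-- Attainment of the infimum defining `S` at positive times. -/
lemma exists_attained_of_pos (hJ : IsGammaZero J) (hJ' : ∀ p, conj J p < ⊤) (hH : IsGammaZero H)
    {x : E} {t c : ℝ} (ht : 0 < t) (hc : ∀ p (h : ℝ), H p ≤ h →
      ((inner ℝ p x - t * h - c : ℝ) : EReal) ≤ conj J p) :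
    ∃ (v : E) (j k : ℝ), J (x - t • v) ≤ j ∧ conj H v ≤ k ∧ j + t * k ≤ c := by
  have hconv : Convex ℝ {q : E × ℝ | (t : EReal) * H q.1 ≤ (q.2 : EReal)} := by
    intro q hq q' hq' a b ha hb hab
    simp only [mem_ofPred_eq, coe_mul_le_coe_iff ht] at *
    refine (le_combo_of_convex_epigraph hH.convex hq hq' ha hb hab).trans
      (EReal.coe_le_coe_iff.2 (le_of_eq ?_))
    simp only [Prod.snd_add, Prod.smul_snd, smul_eq_mul]
    ring
  obtain ⟨w, b, hb, hw⟩ := exists_conj_le_conj_le_of_add (g := conj J)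
    (h := fun p => (t : EReal) * H p) (conj_ne_bot hJ.proper) hJ' (convex_epigraph_conj J)
    (hH.proper.imp fun p hp => (coe_mul_lt_top_iff ht).2 hp)
    (fun p => coe_mul_ne_bot ht (hH.ne_bot p)) hconv (x := x) (α := c)
    (conj_le_coe_iff.2 fun p => by
      by_cases hp : p ∈ dom H
      · obtain ⟨h, hh⟩ := exists_coe_of_mem_dom (hH.ne_bot p) hp
        obtain ⟨a, ha⟩ := exists_coe_of_mem_dom (conj_ne_bot hJ.proper p) (hJ' p)
        have := hc p h hh.le
        rw [ha, EReal.coe_le_coe_iff] at this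
        rw [hh, ha, ← EReal.coe_mul, ← EReal.coe_add, EReal.coe_le_coe_iff, real_inner_comm]
        linarith
      · have : H p = ⊤ := by simpa [dom] using hp
        rw [this, EReal.coe_mul_top_of_pos ht, EReal.add_top_of_ne_bot (conj_ne_bot hJ.proper p)]
        exact le_top)
  rw [hJ.conj_conj] at hb
  -- The witness comes from (tH)^*(x - w) = t H^*((x - w)/t).
  refine ⟨t⁻¹ • (x - w), b, t⁻¹ * (c - b), ?_, conj_le_coe_iff.2 fun p =>
    le_of_forall_le_coe fun h hh => EReal.coe_le_coe_iff.2 ?_, ?_⟩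
  · rwa [smul_inv_smul₀ ht.ne', sub_sub_cancel]
  · have h1 : (t : EReal) * H p ≤ ((t * h : ℝ) : EReal) := by
      rw [coe_mul_le_coe_iff ht, inv_mul_cancel_left₀ ht.ne']
      exact hh
    have h2 := inner_le_add_of_le (f := fun p => (t : EReal) * H p) h1 hw
    rw [real_inner_smul_left, ← mul_sub, inv_mul_le_iff₀ ht]
    linarith
  · rw [mul_inv_cancel_left₀ ht.ne']
    linarith

/-- Absence of a duality gap: weak duality in one direction, an attained infimum in the other. -/
lemma S_le_coe_iff_of_pos (hJ : IsGammaZero J) (hJ' : ∀ p, conj J p < ⊤) (hH : IsGammaZero H)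
    {x : E} {t c : ℝ} (ht : 0 < t) :
    S J H x t ≤ c ↔ ∀ p (h : ℝ), H p ≤ h →
      ((inner ℝ p x - t * h - c : ℝ) : EReal) ≤ conj J p := by
  rw [S, if_pos ht]
  refine ⟨fun hS p h hp => le_of_forall_le_coe fun r hr => ?_, fun h => ?_⟩
  · have : ((inner ℝ p x - t * h - r : ℝ) : EReal) ≤
        ⨅ v : E, (J (x - t • v) + (t : EReal) * conj H v) := by
      refine le_iInf fun v => ?_
      by_cases hv1 : x - t • v ∈ dom J
      swap
      · have h1 : J (x - t • v) = ⊤ := by simpa [dom] using hv1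
        rw [h1, EReal.top_add_of_ne_bot (coe_mul_ne_bot ht (conj_ne_bot hH.proper v))]
        exact le_top
      by_cases hv2 : v ∈ dom (conj H)
      swap
      · have h1 : conj H v = ⊤ := by simpa [dom] using hv2
        rw [h1, EReal.coe_mul_top_of_pos ht, EReal.add_top_of_ne_bot (hJ.ne_bot _)]
        exact le_top
      obtain ⟨j, hj⟩ := exists_coe_of_mem_dom (hJ.ne_bot _) hv1
      obtain ⟨k, hk⟩ := exists_coe_of_mem_dom (conj_ne_bot hH.proper v) hv2
      have h1 := (coe_sub_le_conj_of_le ht.le hj.le hk.le hp).trans hr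
      rw [EReal.coe_le_coe_iff] at h1
      rw [hj, hk, ← EReal.coe_mul, ← EReal.coe_add, EReal.coe_le_coe_iff]
      linarith
    have := EReal.coe_le_coe_iff.1 (this.trans hS)
    rw [EReal.coe_le_coe_iff]
    linarith
  · obtain ⟨v, j, k, hj, hk, hjk⟩ := exists_attained_of_pos hJ hJ' hH ht h
    refine (iInf_le _ v).trans ((add_le_add hj ((coe_mul_le_coe_iff ht (r := t * k)).2 ?_)).trans
      ?_)
    · rwa [inv_mul_cancel_left₀ ht.ne']
    · exact_mod_cast hjk

lemma conj_jointConj (hJ : IsGammaZero J) (hJ' : ∀ p, conj J p < ⊤) (hH : IsGammaZero H) :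
    conj (jointConj J H) = SJoint J H := by
  have key : ∀ (x : E) (t c : ℝ), conj (jointConj J H) (WithLp.toLp 2 (x, t)) ≤ c ↔
      S J H x t ≤ c := by
    intro x t c
    rw [conj_jointConj_le_coe_iff hJ.proper]
    rcases lt_trichotomy t 0 with ht | rfl | ht
    · rw [S, if_neg ht.not_gt, if_neg ht.ne]
      refine ⟨fun h => ?_, fun h => by simp at h⟩
      obtain ⟨p, hp⟩ := hH.proper
      obtain ⟨a, ha⟩ := exists_coe_of_mem_dom (hH.ne_bot p) hp
      obtain ⟨b, hb⟩ := exists_coe_of_mem_dom (conj_ne_bot hJ.proper p) (hJ' p)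
      -- For t < 0, lowering e stays feasible and sends te to +∞; this `d` already violates the
      -- bound by `c`.
      set d := (|b + c - inner ℝ p x| + 1) / (-t)
      have ht' : 0 < -t := by linarith
      have h1 : (-t) * d = |b + c - inner ℝ p x| + 1 := mul_div_cancel₀ _ ht'.ne'
      have h2 : 0 ≤ d := by positivity
      have h3 := h p (-(|a| + d)) (by
        rw [ha, EReal.coe_le_coe_iff]
        linarith [le_abs_self a])
      rw [hb, EReal.coe_le_coe_iff] at h3
      have h4 := le_abs_self (b + c - inner ℝ p x)
      nlinarith [abs_nonneg a]
    · rw [S, if_neg (lt_irrefl _), if_pos rfl, conj_le_coe_iff]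
      refine forall_congr' fun p => ⟨fun h => ?_, fun h e he => ?_⟩
      · by_cases hp : p ∈ dom H
        · obtain ⟨a, ha⟩ := exists_coe_of_mem_dom (hH.ne_bot p) hp
          have := h (-a) (by rw [ha, neg_neg])
          rw [add_ind_of_mem hp, real_inner_comm]
          simpa using this
        · simp [ind, hp, EReal.add_top_of_ne_bot (conj_ne_bot hJ.proper p)]
      · have hp : p ∈ dom H := he.trans_lt (EReal.coe_lt_top _)
        rw [add_ind_of_mem hp, real_inner_comm] at h
        simpa using h
    · rw [S_le_coe_iff_of_pos hJ hJ' hH ht]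
      refine forall_congr' fun p => ⟨fun h a ha => ?_, fun h e he => ?_⟩
      · have := h (-a) (by rwa [neg_neg])
        rwa [mul_neg, ← sub_eq_add_neg] at this
      · have := h (-e) he
        rwa [mul_neg, sub_neg_eq_add] at this
  funext z
  obtain ⟨⟨x, t⟩, rfl⟩ := (WithLp.toLp_surjective 2) z
  exact le_antisymm (le_of_forall_le_coe fun c hc => (key x t c).2 hc)
    (le_of_forall_le_coe fun c hc => (key x t c).1 hc)

lemma isGammaZero_SJoint (hJ : IsGammaZero J) (hJ' : ∀ p, conj J p < ⊤) (hH : IsGammaZero H) :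
    IsGammaZero (SJoint J H) := by
  rw [← conj_jointConj hJ hJ' hH]
  exact (isGammaZero_jointConj hJ hJ' hH).isGammaZero_conj

theorem conj_SJoint (hJ : IsGammaZero J) (hJ' : ∀ p, conj J p < ⊤) (hH : IsGammaZero H) :
    conj (SJoint J H) = jointConj J H := by
  rw [← conj_jointConj hJ hJ' hH, (isGammaZero_jointConj hJ hJ' hH).conj_conj]

end Duality

section Domain

lemma S_lt_top_iff_of_pos {J H : E → EReal} (hJ : IsGammaZero J) (hH : IsGammaZero H) {x : E}
    {t : ℝ} (ht : 0 < t) : S J H x t < ⊤ ↔ x ∈ dom J + t • dom (conj H) := by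
  rw [S, if_pos ht, iInf_lt_iff, Set.mem_add]
  refine ⟨fun ⟨v, hv⟩ => ⟨x - t • v, ?_, t • v, smul_mem_smul_set ?_, sub_add_cancel _ _⟩, ?_⟩
  · by_contra h
    have h1 : J (x - t • v) = ⊤ := by simpa [dom] using h
    rw [h1, EReal.top_add_of_ne_bot (coe_mul_ne_bot ht (conj_ne_bot hH.proper v))] at hv
    exact lt_irrefl _ hv
  · by_contra h
    have h1 : conj H v = ⊤ := by simpa [dom] using h
    rw [h1, EReal.coe_mul_top_of_pos ht, EReal.add_top_of_ne_bot (hJ.ne_bot _)] at hv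
    exact lt_irrefl _ hv
  · rintro ⟨y, hy, w, ⟨v, hv, rfl⟩, rfl⟩
    refine ⟨v, EReal.add_lt_top ?_ ((coe_mul_lt_top_iff ht).2 hv).ne⟩
    simpa using ne_of_lt hy

lemma S_zero (J H : E → EReal) (x : E) :
    S J H x 0 = conj (fun p => conj J p + ind (dom H) p) x := by
  simp [S]

lemma S_of_neg (J H : E → EReal) (x : E) {t : ℝ} (ht : t < 0) : S J H x t = ⊤ := by
  rw [S, if_neg ht.not_gt, if_neg ht.ne]

lemma exists_le_coe_of_lt_top {a : EReal} (h : a < ⊤) : ∃ c : ℝ, a ≤ c := by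
  induction a with
  | bot => exact ⟨0, bot_le⟩
  | top => exact absurd h (lt_irrefl _)
  | coe a => exact ⟨a, le_rfl⟩

variable [CompleteSpace E] [FiniteDimensional ℝ E] {J H : E → EReal}

/-- Since J^* is finite, Fenchel duality splits `x` between J^** = J and the support function of dom
H; the converse adds the two Fenchel-Young bounds. -/
lemma S_zero_lt_top_iff (hJ : IsGammaZero J) (hJ' : ∀ p, conj J p < ⊤) (hH : IsGammaZero H)
    {x : E} : S J H x 0 < ⊤ ↔ x ∈ dom J + dom (conj (ind (dom H))) := by
  rw [S_zero, Set.mem_add]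
  constructor
  · intro h
    obtain ⟨c, hc⟩ := exists_le_coe_of_lt_top h
    obtain ⟨w, b, h1, h2⟩ := exists_conj_le_conj_le_of_add (conj_ne_bot hJ.proper) hJ'
      (convex_epigraph_conj J) (by rw [dom_ind]; exact hH.proper) (ind_ne_bot _)
      (convex_epigraph_ind hH.dom_convex) hc
    rw [hJ.conj_conj] at h1
    exact ⟨w, h1.trans_lt (EReal.coe_lt_top _), x - w, h2.trans_lt (EReal.coe_lt_top _),
      add_sub_cancel _ _⟩
  · rintro ⟨y, hy, w, hw, rfl⟩
    obtain ⟨j, hj⟩ := exists_le_coe_of_lt_top hy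
    obtain ⟨k, hk⟩ := exists_le_coe_of_lt_top hw
    refine lt_of_le_of_lt (b := ((j + k : ℝ) : EReal)) (conj_le_coe_iff.2 fun p =>
      le_of_forall_le_coe fun r hr => EReal.coe_le_coe_iff.2 ?_) (EReal.coe_lt_top _)
    obtain ⟨hp, hr⟩ := (add_ind_le_coe_iff (conj_ne_bot hJ.proper p)).1 hr
    have h1 := inner_le_add_of_le hj hr
    have h2 := inner_le_add_of_le (f := ind (dom H)) (x := p) (a := 0) (by simp [ind, hp]) hk
    rw [inner_add_left, real_inner_comm]
    linarith

theorem dom_SJoint (hJ : IsGammaZero J) (hJ' : ∀ p, conj J p < ⊤) (hH : IsGammaZero H) :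
    dom (SJoint J H) =
      (⋃ t ∈ Ioi (0 : ℝ), WithLp.toLp 2 '' ((dom J + t • dom (conj H)) ×ˢ {t})) ∪
        WithLp.toLp 2 '' ((dom J + dom (conj (ind (dom H)))) ×ˢ {(0 : ℝ)}) := by
  ext z
  obtain ⟨⟨x, t⟩, rfl⟩ := (WithLp.toLp_surjective 2) z
  have h1 : WithLp.toLp 2 (x, t) ∈ dom (SJoint J H) ↔ S J H x t < ⊤ := Iff.rfl
  simp only [h1, mem_union, mem_iUnion, (WithLp.toLp_injective 2).mem_set_image, mem_prod,
    mem_singleton_iff, mem_Ioi, exists_prop]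
  rcases lt_trichotomy t 0 with ht | rfl | ht
  · rw [S_of_neg J H x ht]
    simp only [lt_self_iff_false, false_iff, not_or, not_exists, not_and]
    exact ⟨fun s hs _ h => by linarith, fun _ h => ht.ne h⟩
  · rw [S_zero_lt_top_iff hJ hJ' hH]
    refine ⟨fun h => Or.inr ⟨h, rfl⟩, ?_⟩
    rintro (⟨s, hs, _, h⟩ | h)
    · exact absurd h hs.ne
    · exact h.1
  · rw [S_lt_top_iff_of_pos hJ hH ht]
    refine ⟨fun h => Or.inl ⟨t, ht, h, rfl⟩, ?_⟩
    rintro (⟨s, hs, h, rfl⟩ | h)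
    · exact h
    · exact absurd h.2 ht.ne'

/-- The conjugate of a Legendre function has full-dimensional domain. -/
lemma IsLegendre.interior_dom_conj_nonempty (hH : IsLegendre H) :
    (interior (dom (conj H))).Nonempty := by
  have hΓ := hH.gammaZero
  have hD := hΓ.isGammaZero_conj.dom_convex
  obtain ⟨v₀, hv₀⟩ := hΓ.dom_conj_nonempty
  by_contra hne
  rw [hD.interior_nonempty_iff_affineSpan_eq_top,
    ← AffineSubspace.direction_eq_top_iff_of_nonempty
      ((affineSpan_nonempty ℝ (s := dom (conj H))).2 ⟨v₀, hv₀⟩),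
    ← Submodule.orthogonal_eq_bot_iff, Submodule.eq_bot_iff] at hne
  push Not at hne
  -- If dom H^* were flat, some `d ≠ 0` would be orthogonal to it; then H = H^** is affine along
  -- `d`, against strict convexity on int dom H.
  obtain ⟨d, hd, hd0⟩ := hne
  have hconst : ∀ v ∈ dom (conj H), inner ℝ d v = inner ℝ d v₀ := by
    intro v hv
    have := (Submodule.mem_orthogonal' _ _).1 hd _ (AffineSubspace.vsub_mem_direction
      (mem_affineSpan ℝ hv) (mem_affineSpan ℝ hv₀))
    rw [vsub_eq_sub, inner_sub_right] at this
    linarith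
  have hshift : ∀ (p : E) (s c : ℝ), H p ≤ c →
      H (p + s • d) ≤ ((c + s * inner ℝ d v₀ : ℝ) : EReal) := by
    intro p s c hc
    rw [← hΓ.conj_conj, conj_le_coe_iff]
    intro v
    refine le_of_forall_le_coe fun r hr => EReal.coe_le_coe_iff.2 ?_
    have h1 := inner_le_add_of_le hc hr
    rw [inner_add_left, real_inner_smul_left, hconst v (hr.trans_lt (EReal.coe_lt_top _)),
      real_inner_comm]
    linarith
  obtain ⟨p, hp⟩ := hH.interior_nonempty
  obtain ⟨a, ha⟩ := exists_coe_of_mem_dom (hΓ.ne_bot p) (interior_subset hp)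
  have hval : ∀ s : ℝ, H (p + s • d) = ((a + s * inner ℝ d v₀ : ℝ) : EReal) := by
    intro s
    refine le_antisymm (hshift p s a ha.le) (le_of_forall_le_coe fun r hr => ?_)
    have := hshift _ (-s) r hr
    rw [neg_smul, add_neg_cancel_right, ha, EReal.coe_le_coe_iff] at this
    rw [EReal.coe_le_coe_iff]
    linarith
  have htend : Tendsto (fun s : ℝ => p + s • d) (𝓝[>] 0) (𝓝 p) := by
    refine tendsto_nhdsWithin_of_tendsto_nhds ?_
    have : Continuous fun s : ℝ => p + s • d := by fun_prop
    simpa using this.tendsto 0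
  obtain ⟨s, hs, hs0⟩ := ((htend.eventually_mem (isOpen_interior.mem_nhds hp)).and
    self_mem_nhdsWithin).exists
  have hs0 : 0 < s := hs0
  have hlt := hH.strictConvex.2 hp hs (by simp [hs0.ne', hd0])
    (one_half_pos (α := ℝ)) one_half_pos (add_halves 1)
  have hmid : (1 / 2 : ℝ) • p + (1 / 2 : ℝ) • (p + s • d) = p + (s / 2) • d := by module
  simp only [hmid, hval, ha, EReal.toReal_coe, smul_eq_mul] at hlt
  linarith

/-- Forwards, dom J + t int dom H^* is open, convex and dense in the time slice of the domain, so it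
contains the interior of the slice. Backwards, fix the point of dom J and solve for v, which depends
continuously on (x, t). -/
theorem mem_interior_dom_SJoint_iff (hJ : IsGammaZero J) (hH : IsLegendre H) {x : E} {t : ℝ} :
    WithLp.toLp 2 (x, t) ∈ interior (dom (SJoint J H)) ↔
      0 < t ∧ x ∈ dom J + t • interior (dom (conj H)) := by
  have hΓ := hH.gammaZero
  have hD := hΓ.isGammaZero_conj.dom_convex
  constructor
  · intro hz
    have ht : 0 < t := by
      have htend : Tendsto (fun s : ℝ => WithLp.toLp 2 (x, s)) (𝓝[<] t)
          (𝓝 (WithLp.toLp 2 (x, t))) := by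
        refine tendsto_nhdsWithin_of_tendsto_nhds (Continuous.tendsto ?_ t)
        fun_prop
      obtain ⟨s, hs, hst⟩ := ((htend.eventually_mem (isOpen_interior.mem_nhds hz)).and
        self_mem_nhdsWithin).exists
      have hst : s < t := hst
      by_contra! h
      have h0 : WithLp.toLp 2 (x, s) ∈ dom (SJoint J H) := interior_subset hs
      have h1 : S J H x s < ⊤ := h0
      rw [S_of_neg J H x (by linarith)] at h1
      exact lt_irrefl _ h1
    refine ⟨ht, ?_⟩
    have hx : x ∈ interior (dom J + t • dom (conj H)) := by
      have hcont : Continuous fun y : E => WithLp.toLp 2 (y, t) := by fun_prop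
      have h1 := preimage_interior_subset_interior_preimage (t := dom (SJoint J H)) hcont hz
      refine interior_mono (fun y hy => ?_) h1
      exact (S_lt_top_iff_of_pos hJ hΓ ht).1 hy
    have hopen : IsOpen (dom J + t • interior (dom (conj H))) :=
      (isOpen_interior.smul₀ ht.ne').add_left
    have hconv : Convex ℝ (dom J + t • interior (dom (conj H))) :=
      hJ.dom_convex.add (hD.interior.smul t)
    have hne : (interior (dom J + t • interior (dom (conj H)))).Nonempty := by
      rw [hopen.interior_eq]
      exact hJ.proper.add hH.interior_dom_conj_nonempty.smul_set
    rw [← hopen.interior_eq, ← hconv.interior_closure_eq_interior_of_nonempty_interior hne]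
    refine interior_mono ?_ hx
    rintro _ ⟨y, hy, _, ⟨v, hv, rfl⟩, rfl⟩
    have hv' : v ∈ closure (interior (dom (conj H))) := by
      rw [hD.closure_interior_eq_closure_of_nonempty_interior hH.interior_dom_conj_nonempty]
      exact subset_closure hv
    exact map_mem_closure (f := fun v => y + t • v) (by fun_prop) hv' fun u hu =>
      add_mem_add hy (smul_mem_smul_set hu)
  · rintro ⟨ht, y, hy, _, ⟨v, hv, rfl⟩, rfl⟩
    rw [mem_interior_iff_mem_nhds]
    have hcont : ContinuousAt (fun z : WithLp 2 (E × ℝ) => z.snd⁻¹ • (z.fst - y))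
        (WithLp.toLp 2 (y + t • v, t)) := by
      refine ContinuousAt.smul (ContinuousAt.inv₀ ?_ ht.ne') ?_
      · exact Continuous.continuousAt (by fun_prop)
      · exact Continuous.continuousAt (by fun_prop)
    have h1 : ∀ᶠ z : WithLp 2 (E × ℝ) in 𝓝 (WithLp.toLp 2 (y + t • v, t)),
        z.snd⁻¹ • (z.fst - y) ∈ interior (dom (conj H)) := by
      refine hcont.eventually (isOpen_interior.mem_nhds ?_)
      simpa [inv_smul_smul₀ ht.ne'] using hv
    have h2 : ∀ᶠ z : WithLp 2 (E × ℝ) in 𝓝 (WithLp.toLp 2 (y + t • v, t)), 0 < z.snd :=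
      (Continuous.continuousAt (by fun_prop) : ContinuousAt (fun z : WithLp 2 (E × ℝ) => z.snd)
        _).eventually (isOpen_Ioi.mem_nhds ht)
    filter_upwards [h1, h2] with z hz hz0
    refine (S_lt_top_iff_of_pos hJ hΓ hz0).2 ⟨y, hy, _, smul_mem_smul_set (interior_subset hz), ?_⟩
    simp only [smul_inv_smul₀ hz0.ne', add_sub_cancel]

theorem interior_dom_SJoint (hJ : IsGammaZero J) (hH : IsLegendre H) :
    interior (dom (SJoint J H)) =
      ⋃ t ∈ Ioi (0 : ℝ), WithLp.toLp 2 '' ((dom J + t • interior (dom (conj H))) ×ˢ {t}) := by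
  ext z
  obtain ⟨⟨x, t⟩, rfl⟩ := (WithLp.toLp_surjective 2) z
  rw [mem_interior_dom_SJoint_iff hJ hH]
  simp only [mem_iUnion, (WithLp.toLp_injective 2).mem_set_image, mem_prod, mem_singleton_iff,
    mem_Ioi, exists_prop]
  refine ⟨fun h => ⟨t, h.1, h.2, rfl⟩, ?_⟩
  rintro ⟨s, hs, h, rfl⟩
  exact ⟨hs, h⟩

end Domain

end ValueFunction

end ConvexHJ

namespace ConvexHJ

/-! ### Dual maximizers, the gradient of S and the initial datum -/

section HamiltonJacobi

variable {E : Type*} [NormedAddCommGroup E] [InnerProductSpace ℝ E] {J H : E → EReal}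

lemma coe_le_dualObjective_iff (hJ : IsGammaZero J) (hJ' : ∀ p, conj J p < ⊤)
    (hH : IsGammaZero H) {x p : E} {t s : ℝ} (ht : 0 < t) :
    (s : EReal) ≤ dualObjective J H x t p ↔
      ∃ h : ℝ, H p = h ∧ conj J p ≤ ((inner ℝ p x - t * h - s : ℝ) : EReal) := by
  obtain ⟨a, ha⟩ := exists_coe_of_mem_dom (conj_ne_bot hJ.proper p) (hJ' p)
  rw [dualObjective, ha]
  by_cases hp : p ∈ dom H
  · obtain ⟨h, hh⟩ := exists_coe_of_mem_dom (hH.ne_bot p) hp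
    rw [hh, ← EReal.coe_mul, ← EReal.coe_sub, ← EReal.coe_sub, EReal.coe_le_coe_iff]
    refine ⟨fun hs => ⟨h, rfl, EReal.coe_le_coe_iff.2 (by linarith)⟩, ?_⟩
    rintro ⟨h', h1, h2⟩
    rw [EReal.coe_eq_coe_iff] at h1
    subst h1
    have := EReal.coe_le_coe_iff.1 h2
    linarith
  · have h1 : H p = ⊤ := by simpa [dom] using hp
    simp [h1, EReal.coe_mul_top_of_pos ht]

lemma dualObjective_le_coe_iff (hJ : IsGammaZero J) (hJ' : ∀ p, conj J p < ⊤)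
    (hH : IsGammaZero H) {x p : E} {t s : ℝ} (ht : 0 < t) :
    dualObjective J H x t p ≤ s ↔ ∀ h : ℝ, H p ≤ h →
      ((inner ℝ p x - t * h - s : ℝ) : EReal) ≤ conj J p := by
  obtain ⟨a, ha⟩ := exists_coe_of_mem_dom (conj_ne_bot hJ.proper p) (hJ' p)
  rw [dualObjective, ha]
  by_cases hp : p ∈ dom H
  · obtain ⟨h, hh⟩ := exists_coe_of_mem_dom (hH.ne_bot p) hp
    rw [hh, ← EReal.coe_mul, ← EReal.coe_sub, ← EReal.coe_sub, EReal.coe_le_coe_iff]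
    simp only [EReal.coe_le_coe_iff]
    refine ⟨fun hs h' hh' => ?_, fun hs => ?_⟩
    · nlinarith
    · linarith [hs h le_rfl]
  · have h1 : H p = ⊤ := by simpa [dom] using hp
    simp [h1, EReal.coe_mul_top_of_pos ht]

/-- The initial datum: the conjugate of `J^*` restricted to the closure of `dom H`. -/
lemma isGammaZero_conj_add_ind_closure (hJ : IsGammaZero J) (hJ' : ∀ p, conj J p < ⊤)
    (hH : IsGammaZero H) : IsGammaZero fun p => conj J p + ind (closure (dom H)) p := by
  refine IsGammaZero.add_ind ?_ hH.dom_convex.closure isClosed_closure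
    (hH.proper.imp fun p hp => ⟨hJ' p, subset_closure hp⟩)
  exact isGammaZero_conj hJ.proper ⟨0, hJ' 0⟩

lemma S_zero_le (J H : E → EReal) (x : E) : S J H x 0 ≤ J x := by
  rw [S_zero]
  refine (conj_antitone (fun p => le_add_ind (conj J) (dom H) p) x).trans ?_
  exact conj_conj_le J x

variable [FiniteDimensional ℝ E]

/-- Biconjugation needs a lower semicontinuous function, which J^* + I_{dom H} need not be; the
closure repairs this. -/
lemma S_zero_eq_conj_closure (hJ : IsGammaZero J) (hJ' : ∀ p, conj J p < ⊤) :
    (fun x => S J H x 0) = conj fun p => conj J p + ind (closure (dom H)) p := by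
  rw [conj_add_ind_closure (conj_ne_bot hJ.proper) hJ' (convex_epigraph_conj J)]
  exact funext (S_zero J H)

variable [CompleteSpace E]

/-- Points at which the dual objective attains `S x t` lie in `int dom H`, and are unique. -/
lemma eq_of_coe_le_dualObjective (hJ : IsGammaZero J) (hJ' : ∀ p, conj J p < ⊤)
    (hH : IsLegendre H) {x p q : E} {t s : ℝ} (ht : 0 < t) (hs : S J H x t ≤ s)
    (hp : (s : EReal) ≤ dualObjective J H x t p) (hq : (s : EReal) ≤ dualObjective J H x t q) :
    q = p := by
  have hΓ := hH.gammaZero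
  have hbound := (S_le_coe_iff_of_pos hJ hJ' hΓ ht).1 hs
  obtain ⟨v, j, k, hj, hk, hjk⟩ := exists_attained_of_pos hJ hJ' hΓ ht hbound
  have hint : ∀ r, (s : EReal) ≤ dualObjective J H x t r → r ∈ interior (dom H) := by
    intro r hr
    obtain ⟨h, hh, hr⟩ := (coe_le_dualObjective_iff hJ hJ' hΓ ht).1 hr
    have hrd : r ∈ dom H := by
      change H r < ⊤
      rw [hh]
      exact EReal.coe_lt_top h
    by_contra hri
    have hempty := hH.subdiff_boundary r ⟨hrd, hri⟩
    -- Primal and dual values agree, so Fenchel-Young for H is an equality at (r, v).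
    have hv : v ∈ subdiff H r := by
      rw [mem_subdiff_iff_conj_le hh]
      refine hk.trans (EReal.coe_le_coe_iff.2 ?_)
      have h1 := inner_le_add_of_le hj hr
      rw [inner_sub_right, real_inner_smul_right] at h1
      rw [real_inner_comm]
      have h2 : t * k ≤ t * (inner ℝ r v - h) := by linarith
      exact le_of_mul_le_mul_left h2 ht
    rw [hempty] at hv
    exact hv
  have hpi := hint p hp
  have hqi := hint q hq
  obtain ⟨a, ha, hpJ⟩ := (coe_le_dualObjective_iff hJ hJ' hΓ ht).1 hp
  obtain ⟨b, hb, hqJ⟩ := (coe_le_dualObjective_iff hJ hJ' hΓ ht).1 hq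
  by_contra hne
  have hlt := hH.strictConvex.2 hqi hpi hne (one_half_pos (α := ℝ)) one_half_pos (add_halves 1)
  have hm : (1 / 2 : ℝ) • q + (1 / 2 : ℝ) • p ∈ dom H :=
    hΓ.dom_convex (interior_subset hqi) (interior_subset hpi) one_half_pos.le one_half_pos.le
      (add_halves 1)
  obtain ⟨c, hc⟩ := exists_coe_of_mem_dom (hΓ.ne_bot _) hm
  have hmJ := le_combo_of_convex_epigraph (convex_epigraph_conj J) hqJ hpJ
    (one_half_pos (α := ℝ)).le one_half_pos.le (add_halves 1)
  -- By strict convexity the midpoint of two maximizers would have dual value above `s`.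
  have h1 := EReal.coe_le_coe_iff.1 ((hbound _ c hc.le).trans hmJ)
  simp only [hc, ha, hb, EReal.toReal_coe, smul_eq_mul] at hlt
  rw [inner_add_left, real_inner_smul_left, real_inner_smul_left] at h1
  nlinarith

/-- Subgradients of the joint value function at positive times. -/
lemma eq_neg_and_le_dualObjective_of_mem_subdiff (hJ : IsGammaZero J)
    (hJ' : ∀ p, conj J p < ⊤) (hH : IsGammaZero H) {x p : E} {t s e : ℝ} (ht : 0 < t)
    (hs : S J H x t = s)
    (hpe : WithLp.toLp 2 (p, e) ∈ subdiff (SJoint J H) (WithLp.toLp 2 (x, t))) :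
    H p = ((-e : ℝ) : EReal) ∧ (s : EReal) ≤ dualObjective J H x t p := by
  have hin : inner ℝ (WithLp.toLp 2 (p, e)) (WithLp.toLp 2 (x, t)) = inner ℝ p x + t * e := by
    rw [WithLp.prod_inner_apply]
    simp
  rw [mem_subdiff_iff_conj_le (f := SJoint J H) (x := WithLp.toLp 2 (x, t)) hs,
    conj_SJoint hJ hJ' hH, jointConj_le_coe_iff hJ.proper, hin] at hpe
  obtain ⟨h1, h2⟩ := hpe
  have hp : p ∈ dom H := h1.trans_lt (EReal.coe_lt_top _)
  obtain ⟨a, ha⟩ := exists_coe_of_mem_dom (hH.ne_bot p) hp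
  have h3 := (S_le_coe_iff_of_pos hJ hJ' hH ht).1 hs.le p a ha.le
  have h4 := EReal.coe_le_coe_iff.1 (h3.trans h2)
  rw [ha, EReal.coe_le_coe_iff] at h1
  -- Feasibility gives H(p) ≤ -e; the dual lower bound on S gives the reverse, after dividing by t >
  -- 0.
  have h5 : a = -e := by
    have : t * (-e) ≤ t * a := by linarith
    exact le_antisymm h1 (le_of_mul_le_mul_left this ht)
  refine ⟨by rw [ha, h5], (coe_le_dualObjective_iff hJ hJ' hH ht).2 ⟨a, ha, h2.trans ?_⟩⟩
  rw [EReal.coe_le_coe_iff, h5]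
  linarith

/-- An interior point has a subgradient, whose first component attains S in the dual problem.
Uniqueness of such points makes the subdifferential a singleton. -/
theorem exists_uniqueMaximizer_and_hasGradientAt (hJ : IsGammaZero J)
    (hJ' : ∀ p, conj J p < ⊤) (hH : IsLegendre H) {x : E} {t : ℝ}
    (hz : WithLp.toLp 2 (x, t) ∈ interior (dom (SJoint J H))) :
    ∃ p ∈ dom H, IsUniqueMaximizer (dualObjective J H x t) p ∧
      HasGradientAt (fun z => (SJoint J H z).toReal)
        (WithLp.toLp 2 (p, -(H p).toReal)) (WithLp.toLp 2 (x, t)) := by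
  have hΓ := hH.gammaZero
  have hS := isGammaZero_SJoint hJ hJ' hΓ
  have ht := ((mem_interior_dom_SJoint_iff hJ hH).1 hz).1
  obtain ⟨s, hs⟩ := exists_coe_of_mem_dom (hS.ne_bot _) (interior_subset hz)
  replace hs : S J H x t = s := hs
  obtain ⟨w, hw⟩ := subdiff_nonempty_of_mem_interior hS.ne_bot hS.convex hz
  obtain ⟨⟨p, e⟩, rfl⟩ := (WithLp.toLp_surjective 2) w
  obtain ⟨hp, hps⟩ := eq_neg_and_le_dualObjective_of_mem_subdiff hJ hJ' hΓ ht hs hw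
  refine ⟨p, ?_, ⟨fun q => ?_, fun r hr => ?_⟩,
    hasGradientAt_of_subdiff_subset_singleton hS.ne_bot hS.convex hz fun w' hw' => ?_⟩
  · change H p < ⊤
    rw [hp]
    exact EReal.coe_lt_top _
  · refine le_trans ?_ hps
    rw [dualObjective_le_coe_iff hJ hJ' hΓ ht]
    exact (S_le_coe_iff_of_pos hJ hJ' hΓ ht).1 hs.le q
  · exact eq_of_coe_le_dualObjective hJ hJ' hH ht hs.le hps (hps.trans (hr p))
  · obtain ⟨⟨p', e'⟩, rfl⟩ := (WithLp.toLp_surjective 2) w'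
    obtain ⟨hp', hps'⟩ := eq_neg_and_le_dualObjective_of_mem_subdiff hJ hJ' hΓ ht hs hw'
    obtain rfl := eq_of_coe_le_dualObjective hJ hJ' hH ht hs.le hps hps'
    rw [mem_singleton_iff, hp', EReal.toReal_coe, neg_neg]

theorem isInitialDatum_S_zero (hJ : IsGammaZero J) (hJ' : ∀ p, conj J p < ⊤)
    (hH : IsGammaZero H) : IsInitialDatum J H fun x => S J H x 0 := by
  have hG := isGammaZero_conj_add_ind_closure hJ hJ' hH
  rw [S_zero_eq_conj_closure hJ hJ']
  have hdom : dom (fun p => conj J p + ind (closure (dom H)) p) = closure (dom H) := by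
    rw [dom_add_ind (conj_ne_bot hJ.proper)]
    exact inter_eq_right.2 fun p _ => hJ' p
  refine ⟨hG.isGammaZero_conj, by rw [hG.conj_conj, hdom], fun p hp => ?_⟩
  rw [hG.conj_conj, hdom] at hp
  rw [hG.conj_conj]
  exact add_ind_of_mem hp

/-- The conditions determine the conjugate of `JS` everywhere, and a Γ₀ function is determined by
its conjugate. -/
theorem IsInitialDatum.eq_S_zero {JS : E → EReal} (hJS : IsInitialDatum J H JS)
    (hJ : IsGammaZero J) (hJ' : ∀ p, conj J p < ⊤) : JS = fun x => S J H x 0 := by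
  rw [S_zero_eq_conj_closure hJ hJ', ← hJS.gammaZero.conj_conj]
  congr 1
  funext p
  by_cases hp : p ∈ closure (dom H)
  · rw [add_ind_of_mem hp, hJS.conj_eq p (hJS.dom_conj ▸ hp)]
  · have h1 : conj JS p = ⊤ := by
      rw [← hJS.dom_conj] at hp
      simpa [dom] using hp
    simp [h1, ind, hp, EReal.add_top_of_ne_bot (conj_ne_bot hJ.proper p)]

theorem solvesHJ (hJ : IsGammaZero J) (hJ' : ∀ p, conj J p < ⊤) (hH : IsLegendre H)
    {JS : E → EReal} (hJS : IsInitialDatum J H JS) : SolvesHJ H JS (S J H) := by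
  refine ⟨fun x t hxt => ?_, fun x => by rw [hJS.eq_S_zero hJ hJ']⟩
  have hz : WithLp.toLp 2 (x, t) ∈ interior (dom (SJoint J H)) := by
    have hcont : Continuous (WithLp.ofLp : WithLp 2 (E × ℝ) → E × ℝ) :=
      WithLp.prod_continuous_ofLp 2 E ℝ
    exact preimage_interior_subset_interior_preimage hcont
      (show WithLp.toLp 2 (x, t) ∈ WithLp.ofLp ⁻¹' interior {z : E × ℝ | S J H z.1 z.2 < ⊤}
        from hxt)
  obtain ⟨p, hp, -, hgrad⟩ := exists_uniqueMaximizer_and_hasGradientAt hJ hJ' hH hz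
  obtain ⟨a, ha⟩ := exists_coe_of_mem_dom (hH.gammaZero.ne_bot p) hp
  rw [ha, EReal.toReal_coe] at hgrad
  -- The derivative is moved from the Euclidean product to the plain product, where the partial
  -- derivatives come from the chain rule.
  have hF : HasFDerivAt (fun z : E × ℝ => (S J H z.1 z.2).toReal)
      ((InnerProductSpace.toDual ℝ E p).coprod (ContinuousLinearMap.toSpanSingleton ℝ (-a)))
      (x, t) := by
    have h1 := hgrad.hasFDerivAt.comp (x, t)
      (WithLp.prodContinuousLinearEquiv 2 ℝ E ℝ).symm.hasFDerivAt
    refine h1.congr_fderiv (ContinuousLinearMap.ext fun y => ?_)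
    simp [WithLp.prod_inner_apply]
  have ht : HasDerivAt (fun s => (S J H x s).toReal) (-a) t := by
    have h1 := hF.comp_hasDerivAt t ((hasDerivAt_const t x).prodMk (hasDerivAt_id t))
    simpa [Function.comp_def] using h1
  have hx : HasGradientAt (fun y => (S J H y t).toReal) p x := by
    have h1 := HasFDerivAt.comp (f := fun y => (y, t)) x hF (hasFDerivAt_prodMk_left x t)
    rw [hasGradientAt_iff_hasFDerivAt]
    exact h1.congr_fderiv (ContinuousLinearMap.ext fun y => by simp)
  refine ⟨ht.differentiableAt, hx.differentiableAt, ?_⟩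
  rw [ht.deriv, hx.gradient, ha, ← EReal.coe_add, neg_add_cancel, EReal.coe_zero]

/-- A subgradient of J in cl dom H is admissible in the supremum for S(x, 0) and already yields
J(x). With equal values, the two Fenchel-Young equalities differ only by the indicator of cl dom H.
-/
theorem S_zero_eq_and_subdiff_eq (hJ : IsGammaZero J) (hJ' : ∀ p, conj J p < ⊤)
    (hH : IsGammaZero H) {x : E} (hx : x ∈ dom J)
    (hne : (subdiff J x ∩ closure (dom H)).Nonempty) :
    S J H x 0 = J x ∧
      subdiff (fun y => S J H y 0) x = subdiff J x ∩ closure (dom H) := by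
  obtain ⟨a, ha⟩ := exists_coe_of_mem_dom (hJ.ne_bot x) hx
  have hSx : S J H x 0 = J x := by
    obtain ⟨p, hp, hpH⟩ := hne
    refine le_antisymm (S_zero_le J H x) ?_
    rw [mem_subdiff_iff_conj_le ha] at hp
    rw [ha]
    refine le_of_forall_le_coe fun c hc => ?_
    rw [congr_fun (S_zero_eq_conj_closure hJ hJ') x, conj_le_coe_iff] at hc
    have h1 := hc p
    rw [add_ind_of_mem hpH] at h1
    have h2 := EReal.coe_le_coe_iff.1 (h1.trans hp)
    rw [EReal.coe_le_coe_iff]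
    rw [real_inner_comm] at h2
    linarith
  refine ⟨hSx, Set.ext fun p => ?_⟩
  rw [mem_subdiff_iff_conj_le (f := fun y => S J H y 0) (hSx.trans ha), S_zero_eq_conj_closure hJ hJ',
    (isGammaZero_conj_add_ind_closure hJ hJ' hH).conj_conj,
    add_ind_le_coe_iff (conj_ne_bot hJ.proper p), mem_inter_iff, mem_subdiff_iff_conj_le ha,
    and_comm]

end HamiltonJacobi

end ConvexHJ

open ConvexHJ
theorem proposition5p1 (n : ℕ) (J H : EuclideanSpace ℝ (Fin n) → EReal)
    (hJ : IsGammaZero J) (hJc : IsOneCoercive J) (hH : IsLegendre H) :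
    -- (a) `S` is proper, jointly convex and lsc, and its Legendre-Fenchel transform
    (IsGammaZero (SJoint J H) ∧
      ∀ (p : EuclideanSpace ℝ (Fin n)) (e : ℝ),
        conj (SJoint J H) (WithLp.toLp 2 (p, e)) =
          conj J p + ind {q : EuclideanSpace ℝ (Fin n) × ℝ |
            q.1 ∈ dom H ∧ (q.2 : EReal) + H q.1 ≤ 0} (p, e)) ∧
    -- (b) the domain of `S` and its interior
    (dom (SJoint J H) =
        (⋃ t ∈ Ioi (0 : ℝ), WithLp.toLp 2 '' ((dom J + t • dom (conj H)) ×ˢ {t})) ∪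
          WithLp.toLp 2 '' ((dom J + dom (conj (ind (dom H)))) ×ˢ {(0 : ℝ)}) ∧
      interior (dom (SJoint J H)) =
        ⋃ t ∈ Ioi (0 : ℝ), WithLp.toLp 2 '' ((dom J + t • interior (dom (conj H))) ×ˢ {t})) ∧
    -- (c) differentiability and the gradient
    (∀ (x : EuclideanSpace ℝ (Fin n)) (t : ℝ),
      WithLp.toLp 2 (x, t) ∈ interior (dom (SJoint J H)) →
        ∃ p ∈ dom H, IsUniqueMaximizer (dualObjective J H x t) p ∧
          HasGradientAt (fun z => (SJoint J H z).toReal)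
            (WithLp.toLp 2 (p, -(H p).toReal)) (WithLp.toLp 2 (x, t))) ∧
    -- (d) the Hamilton-Jacobi equation
    ((∃ JS, IsInitialDatum J H JS) ∧
      ∀ JS, IsInitialDatum J H JS → SolvesHJ H JS (S J H)) ∧
    -- (e) comparison with `J` at time zero
    ((∀ x, S J H x 0 ≤ J x) ∧
      ∀ x ∈ dom J, (subdiff J x ∩ closure (dom H)).Nonempty →
        S J H x 0 = J x ∧
          subdiff (fun y => S J H y 0) x = subdiff J x ∩ closure (dom H)) := by
  have hJ' : ∀ p, conj J p < ⊤ := hJc.conj_lt_top hJ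
  have hΓ := hH.gammaZero
  exact ⟨⟨isGammaZero_SJoint hJ hJ' hΓ, fun p e => by rw [conj_SJoint hJ hJ' hΓ]; rfl⟩,
    ⟨dom_SJoint hJ hJ' hΓ, interior_dom_SJoint hJ hH⟩,
    fun x t hz => exists_uniqueMaximizer_and_hasGradientAt hJ hJ' hH hz,
    ⟨⟨_, isInitialDatum_S_zero hJ hJ' hΓ⟩, fun JS hJS => solvesHJ hJ hJ' hH hJS⟩,
    S_zero_le J H, fun x hx hne => S_zero_eq_and_subdiff_eq hJ hJ' hΓ hx hne⟩
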